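/- $C^*$-algebras are complex, not necessarily unital or separable; morphisms are $*$-homomorphisms. Let $\Sigma A=\{f\in C([0,1],A): f(0)=f(1)=0\}$, and let $\mathcal H(A,B)$ be the set of homotopy classes of $*$-homomorphisms $A\to B$. The stable homotopy category $\mathcal{SH}$ has objects $A_m$ ($A$ a $C^*$-algebra, $m\in\mathbb Z$) and morphisms $$\mathcal{SH}(A_m,B_n)=\varinjlim_{k}\mathcal H(\Sigma^{m+k}A,\Sigma^{n+k}B),$$ the limit being over $k$ with $m+k,n+k\ge 0$, with connecting maps $f\mapsto\Sigma f$. Write $A=A_0$ and let $\Sigma(A_m)=A_{m+1}$ be the shift functor of $\mathcal{SH}$. A split extension is a sequence $I\xrightarrow{\iota}A\xrightarrow{\pi}B$ of $*$-homomorphisms in which $\iota$ is injective with image $\ker\pi$ and $\pi$ has a right inverse $*$-homomorphism. Let $X$ be the class of morphisms of $\mathcal{SH}$ generated under composition by all isomorphisms and by the morphisms $\iota_m:I_m\to A_m$, $m\in\mathbb Z$, where $\iota$ is the kernel inclusion of a split extension $I\to A\to B$ with $B$ contractible. Let $\mathcal{SH}(X^{-1})$ be the localisation of $\mathcal{SH}$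 at $X$; the shift induces an endofunctor $\Sigma$ of it, and $\Sigma^2(A_0)=A_2\cong(\Sigma^2A)_0$ canonically. A functor from $C^*$-algebras to a preadditive category is split exact if it maps every split extension $I\to A\to B$ to a split short exact sequence $0\to F(I)\to F(A)\to F(B)\to 0$ (for contravariant $F$: $0\to F(B)\to F(A)\to F(I)\to 0$). It is homotopy invariant if homotopic homomorphisms have the same image. A Bott periodic functor is a functor $F$ with a natural isomorphism $\beta: F(A)\cong F(\Sigma^2A)$; likewise for functors on $\mathcal{SH}(X^{-1})$ and its $\Sigma$. **Theorem.** (1) $\mathcal{SH}$ is a preadditive category under an addition induced by concatenation, $\mathcal{SH}(X^{-1})$ has a preadditive structure for which $\mathcal{SH}\to\mathcal{SH}(X^{-1})$ is additive, and for every $C^*$-algebra $D$ the functors $A\mapsto\mathcal{SH}(X^{-1})(D,A)$ and $A\mapsto\mathcal{SH}(X^{-1})(A,D)$ from $C^*$-algebras to abelian groups are split exact. (2) Let $F$ be a functor from $C^*$-algebras to a preadditive category $\mathcal A$ that is split exact, homotopy invariant and Bott periodic, with periodicity isomorphism $\beta$. Then $F$ factors uniquely through $\mathcal{SH}(X^{-1})$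 as a Bott periodic functor: there is a functor $\tilde F:\mathcal{SH}(X^{-1})\to\mathcal A$ with a natural isomorphism $\tilde\beta:\tilde F\cong\tilde F\circ\Sigma^2$ and a natural isomorphism $F(A)\cong\tilde F(A_0)$ under which $\beta$ corresponds to $\tilde\beta$ (via $\Sigma^2(A_0)\cong(\Sigma^2A)_0$); and between any two such factorisations there is exactly one natural isomorphism compatible with the identifications with $F$ and with the periodicity isomorphisms. -/

import Mathlib

open CategoryTheory

universe u v w

noncomputable section

/-! ### The category of C⋆-algebras -/

/-- A complex C⋆-algebra: not necessarily unital, not necessarily separable, possibly zero. -/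
structure CStarAlgCat : Type (u + 1) where
  carrier : Type u
  [str : NonUnitalCStarAlgebra carrier]

namespace CStarAlgCat

instance : CoeSort CStarAlgCat.{u} (Type u) := ⟨CStarAlgCat.carrier⟩

instance (A : CStarAlgCat.{u}) : NonUnitalCStarAlgebra A := A.str

/-- Morphisms are the (not necessarily unital) `⋆`-homomorphisms. -/
instance : Category.{u} CStarAlgCat.{u} where
  Hom A B := A →⋆ₙₐ[ℂ] B
  id A := NonUnitalStarAlgHom.id ℂ A
  comp f g := NonUnitalStarAlgHom.comp g f

/-- The `⋆`-homomorphism underlying a morphism. -/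
def Hom.star {A B : CStarAlgCat.{u}} (f : A ⟶ B) : A →⋆ₙₐ[ℂ] B := f

/-- A `⋆`-homomorphism as a morphism. -/
def ofStar {A B : CStarAlgCat.{u}} (f : A →⋆ₙₐ[ℂ] B) : A ⟶ B := f

/-- The zero homomorphism. -/
def zeroHom (A B : CStarAlgCat.{u}) : A ⟶ B := ofStar 0

lemma continuous_star {A B : CStarAlgCat.{u}} (f : A ⟶ B) : Continuous (Hom.star f) :=
  AddMonoidHomClass.continuous_of_bound (Hom.star f) 1 fun a => by
    simpa using NonUnitalStarAlgHom.norm_apply_le (Hom.star f) a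

/-! ### Homotopy -/

/-- Two homomorphisms are homotopic if they are the endpoints of a path of homomorphisms that is
continuous at every element (equivalently, of a homomorphism `A → C([0,1], B)`). -/
def Homotopic : HomRel CStarAlgCat.{u} := fun A B f g =>
  ∃ h : unitInterval → (A ⟶ B),
    (∀ a : A, Continuous fun t => Hom.star (h t) a) ∧ h 0 = f ∧ h 1 = g

/-- Homotopy is an equivalence relation compatible with composition. -/
instance : Congruence Homotopic.{u} where
  equivalence := by
    intro A B
    refine ⟨fun f => ⟨fun _ => f, fun a => continuous_const, rfl, rfl⟩, ?_, ?_⟩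
    · rintro f g ⟨h, hc, h0, h1⟩
      refine ⟨fun t => h (unitInterval.symm t), fun a => (hc a).comp unitInterval.continuous_symm,
        ?_, ?_⟩
      · simpa using h1
      · simpa using h0
    · rintro f g k ⟨h, hc, h0, h1⟩ ⟨h', hc', h0', h1'⟩
      let E : ℝ → unitInterval := Set.projIcc 0 1 zero_le_one
      have hE : Continuous E := continuous_projIcc
      have hE1 : E 1 = 1 := Set.projIcc_right zero_le_one
      have hE0 : E 0 = 0 := Set.projIcc_left zero_le_one
      refine ⟨fun t => if (t : ℝ) ≤ 1 / 2 then h (E (2 * t)) else h' (E (2 * t - 1)), ?_, ?_, ?_⟩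
      · intro a
        have : (fun t : unitInterval => Hom.star (if (t : ℝ) ≤ 1 / 2 then h (E (2 * t))
            else h' (E (2 * t - 1))) a) = fun t : unitInterval => if (t : ℝ) ≤ 1 / 2 then
            Hom.star (h (E (2 * t))) a else Hom.star (h' (E (2 * t - 1))) a := by
          funext t; split_ifs <;> rfl
        rw [this]
        refine Continuous.if_le ((hc a).comp (by fun_prop)) ((hc' a).comp (by fun_prop))
          (by fun_prop) (by fun_prop) ?_
        intro t ht
        have e1 : (2 * (t : ℝ)) = 1 := by rw [ht]; norm_num
        rw [e1, sub_self, hE1, hE0, h1, h0']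
      · simp [hE0, h0]
      · have e2 : (2 * (1 : ℝ) - 1) = 1 := by norm_num
        have e3 : ¬ ((1 : ℝ) ≤ 1 / 2) := by norm_num
        show (if (1 : ℝ) ≤ 1 / 2 then h (E (2 * 1)) else h' (E (2 * 1 - 1))) = k
        rw [if_neg e3, e2, hE1, h1']
  comp_left := by
    rintro A B C f g g' ⟨h, hc, rfl, rfl⟩
    exact ⟨fun t => f ≫ h t, fun a => hc (Hom.star f a), rfl, rfl⟩
  comp_right := by
    rintro A B C f f' g ⟨h, hc, rfl, rfl⟩
    exact ⟨fun t => h t ≫ g, fun a => (continuous_star g).comp (hc a), rfl, rfl⟩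

/-- A C⋆-algebra is contractible if its identity is homotopic to zero. -/
def IsContractible (A : CStarAlgCat.{u}) : Prop := Homotopic (𝟙 A) (zeroHom A A)

/-! ### Suspension -/

/-- The loops `f : [0,1] → A` with `f 0 = f 1 = 0`, inside `C([0,1], A)`. -/
def loops (A : CStarAlgCat.{u}) : NonUnitalStarSubalgebra ℂ C(unitInterval, A) where
  carrier := {f | f 0 = 0 ∧ f 1 = 0}
  add_mem' := by rintro f g ⟨h0, h1⟩ ⟨h0', h1'⟩; simp [h0, h1, h0', h1']
  zero_mem' := by simp
  mul_mem' := by rintro f g ⟨h0, h1⟩ ⟨h0', h1'⟩; simp [h0, h1]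
  smul_mem' := by rintro c f ⟨h0, h1⟩; simp [h0, h1]
  star_mem' := by rintro f ⟨h0, h1⟩; simp [h0, h1]

instance (A : CStarAlgCat.{u}) : IsClosed (loops A : Set C(unitInterval, A)) :=
  (isClosed_eq (continuous_eval_const 0) continuous_const).inter
    (isClosed_eq (continuous_eval_const 1) continuous_const)

/-- The suspension `ΣA = {f ∈ C([0,1], A) | f 0 = f 1 = 0} ≅ C₀((0,1), A)`. -/
def susp (A : CStarAlgCat.{u}) : CStarAlgCat.{u} where
  carrier := loops A

/-- `Σφ` is composition with `φ`. -/
def suspMap {A B : CStarAlgCat.{u}} (φ : A ⟶ B) : susp A ⟶ susp B := ofStar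
  { toFun := fun f => (⟨⟨fun t => Hom.star φ (f.1 t), (continuous_star φ).comp f.1.continuous⟩, by
      have h0 := f.2.1
      have h1 := f.2.2
      constructor
      · show Hom.star φ (f.1 0) = 0
        rw [h0, map_zero]
      · show Hom.star φ (f.1 1) = 0
        rw [h1, map_zero]⟩ : loops B)
    map_smul' := fun c f => Subtype.ext <| ContinuousMap.ext fun t =>
      map_smul (Hom.star φ) c (f.1 t)
    map_zero' := Subtype.ext <| ContinuousMap.ext fun t => map_zero (Hom.star φ)
    map_add' := fun f g => Subtype.ext <| ContinuousMap.ext fun t =>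
      map_add (Hom.star φ) (f.1 t) (g.1 t)
    map_mul' := fun f g => Subtype.ext <| ContinuousMap.ext fun t =>
      map_mul (Hom.star φ) (f.1 t) (g.1 t)
    map_star' := fun f => Subtype.ext <| ContinuousMap.ext fun t =>
      map_star (Hom.star φ) (f.1 t) }

/-- The suspension functor on C⋆-algebras. -/
def suspension : CStarAlgCat.{u} ⥤ CStarAlgCat.{u} where
  obj := susp
  map := suspMap

/-- Suspension respects homotopy. -/
lemma Homotopic.susp {A B : CStarAlgCat.{u}} {f g : A ⟶ B} (H : Homotopic f g) :
    Homotopic (suspMap f) (suspMap g) := by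
  obtain ⟨h, hc, rfl, rfl⟩ := H
  refine ⟨fun t => suspMap (h t), fun a => ?_, rfl, rfl⟩
  have hj : Continuous fun p : unitInterval × A => Hom.star (h p.1) p.2 := by
    rw [continuous_iff_continuousAt]
    rintro ⟨t, a⟩
    rw [ContinuousAt, tendsto_iff_norm_sub_tendsto_zero]
    have h1 : Filter.Tendsto (fun p : unitInterval × A => ‖p.2 - a‖ +
        ‖Hom.star (h p.1) a - Hom.star (h t) a‖) (nhds (t, a)) (nhds 0) := by
      have : Continuous (fun p : unitInterval × A => ‖p.2 - a‖ +
        ‖Hom.star (h p.1) a - Hom.star (h t) a‖) :=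
        (by fun_prop : Continuous fun p : unitInterval × A => ‖p.2 - a‖).add
          ((((hc a).comp continuous_fst).sub continuous_const).norm)
      simpa using this.tendsto (t, a)
    refine squeeze_zero (fun _ => norm_nonneg _) (fun p => ?_) h1
    calc ‖Hom.star (h p.1) p.2 - Hom.star (h t) a‖
        = ‖Hom.star (h p.1) (p.2 - a) + (Hom.star (h p.1) a - Hom.star (h t) a)‖ := by
          rw [map_sub]; congr 1; abel
      _ ≤ _ := (norm_add_le _ _).trans
          (add_le_add (NonUnitalStarAlgHom.norm_apply_le _ _) le_rfl)
  have hk : Continuous fun p : unitInterval × unitInterval => Hom.star (h p.1) (a.1 p.2) :=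
    hj.comp (continuous_fst.prodMk (a.1.continuous.comp continuous_snd))
  exact Continuous.subtype_mk (ContinuousMap.curry ⟨_, hk⟩).continuous _

/-! ### Concatenation -/

/-- The parametrisations `t ↦ min (2t) 1` and `t ↦ max (2t - 1) 0` of `[0,1]`. -/
def firstHalf : C(unitInterval, unitInterval) :=
  ⟨fun t => Set.projIcc 0 1 zero_le_one (2 * (t : ℝ)), continuous_projIcc.comp (by fun_prop)⟩

/-- The second half, see `firstHalf`. -/
def secondHalf : C(unitInterval, unitInterval) :=
  ⟨fun t => Set.projIcc 0 1 zero_le_one (2 * (t : ℝ) - 1), continuous_projIcc.comp (by fun_prop)⟩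

lemma firstHalf_eq_one_or (t : unitInterval) : firstHalf t = 1 ∨ secondHalf t = 0 := by
  by_cases h : (1 : ℝ) ≤ 2 * t
  · exact Or.inl (Set.projIcc_of_right_le zero_le_one h)
  · exact Or.inr (Set.projIcc_of_le_left zero_le_one (by linarith))

/-- The concatenation of loops: `f (2t)` for `t ≤ 1/2` and `g (2t - 1)` for `t ≥ 1/2`. It is written
as a sum because one of the two terms always vanishes. -/
def loopConcat {A : CStarAlgCat.{u}} (f g : loops A) : loops A :=
  ⟨f.1.comp firstHalf + g.1.comp secondHalf, by
    have a0 : firstHalf 0 = 0 := by simp [firstHalf]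
    have a1 : firstHalf 1 = 1 := Set.projIcc_of_right_le zero_le_one (by norm_num)
    have b0 : secondHalf 0 = 0 := Set.projIcc_of_le_left zero_le_one (by norm_num)
    have b1 : secondHalf 1 = 1 := Set.projIcc_of_right_le zero_le_one (by norm_num)
    constructor
    · show f.1 (firstHalf 0) + g.1 (secondHalf 0) = 0
      rw [a0, b0, f.2.1, g.2.1, add_zero]
    · show f.1 (firstHalf 1) + g.1 (secondHalf 1) = 0
      rw [a1, b1, f.2.2, g.2.2, add_zero]⟩

/-- The pointwise concatenation of two homomorphisms into a suspension. -/
def concat {A B : CStarAlgCat.{u}} (f g : A ⟶ susp B) : A ⟶ susp B := ofStar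
  { toFun := fun a => loopConcat (Hom.star f a) (Hom.star g a)
    map_smul' := fun c a => by
      rw [map_smul, map_smul]
      exact Subtype.ext (ContinuousMap.ext fun t => (smul_add c _ _).symm)
    map_zero' := by
      rw [map_zero, map_zero]
      exact Subtype.ext (ContinuousMap.ext fun t => add_zero _)
    map_add' := fun a b => by
      rw [map_add, map_add]
      exact Subtype.ext (ContinuousMap.ext fun t => add_add_add_comm _ _ _ _)
    map_mul' := fun a b => by
      rw [map_mul, map_mul]
      refine Subtype.ext (ContinuousMap.ext fun t => ?_)
      generalize Hom.star f a = x, Hom.star f b = x', Hom.star g a = y, Hom.star g b = y'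
      change loops B at x x' y y'
      show x.1 (firstHalf t) * x'.1 (firstHalf t) + y.1 (secondHalf t) * y'.1 (secondHalf t) =
        (x.1 (firstHalf t) + y.1 (secondHalf t)) * (x'.1 (firstHalf t) + y'.1 (secondHalf t))
      rcases firstHalf_eq_one_or t with h | h
      · rw [h, x.2.2, x'.2.2]; simp
      · rw [h, y.2.1, y'.2.1]; simp
    map_star' := fun a => by
      rw [map_star, map_star]
      exact Subtype.ext (ContinuousMap.ext fun t => (star_add _ _).symm) }

end CStarAlgCat

/-! ### Stabilisation of a category along an endofunctor -/

/-- The iterates `S^p X`, with `S^(p+1) X = S (S^p X)`. -/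
def iter {H : Type v} [Category.{w} H] (S : H ⥤ H) : ℕ → H → H
  | 0, X => X
  | p + 1, X => S.obj (iter S p X)

/-- Objects of the stabilisation: pairs `X_m` of an object `X` and an integer `m`. -/
structure Stab {H : Type v} [Category.{w} H] (S : H ⥤ H) where
  obj : H
  deg : ℤ

namespace Stab

variable {H : Type v} [Category.{w} H] {S : H ⥤ H}

/-- A representative of a morphism `X_m ⟶ Y_n`: a morphism `S^(m+k) X ⟶ S^(n+k) Y` for some integer
`k` with `p = m + k ≥ 0` and `q = n + k ≥ 0`. -/
@[ext]
structure Rep (X Y : Stab S) where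
  p : ℕ
  q : ℕ
  h : (p : ℤ) - X.deg = (q : ℤ) - Y.deg
  f : iter S p X.obj ⟶ iter S q Y.obj

/-- The connecting map from stage `k` to stage `k + 1`. -/
def Rep.succ {X Y : Stab S} (r : Rep X Y) : Rep X Y where
  p := r.p + 1
  q := r.q + 1
  h := by have := r.h; push_cast; linarith
  f := S.map r.f

/-- Morphisms `X_m ⟶ Y_n`: the direct limit over `k` of the sets of morphisms
`S^(m+k) X ⟶ S^(n+k) Y`, i.e. representatives modulo the equivalence relation generated by
identifying `f` with `S f`. -/
def Hom (X Y : Stab S) : Type w := Quot fun r r' : Rep X Y => r' = r.succ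

/-- The class of a representative. -/
def Rep.mk' {X Y : Stab S} (r : Rep X Y) : Hom X Y := Quot.mk _ r

/-- The image of a representative `j` stages later. -/
def Rep.lift {X Y : Stab S} (r : Rep X Y) : ℕ → Rep X Y
  | 0 => r
  | j + 1 => (r.lift j).succ

lemma Rep.lift_p {X Y : Stab S} (r : Rep X Y) (j : ℕ) : (r.lift j).p = r.p + j := by
  induction j with
  | zero => rfl
  | succ j ih => show (r.lift j).p + 1 = _; omega

lemma Rep.lift_q {X Y : Stab S} (r : Rep X Y) (j : ℕ) : (r.lift j).q = r.q + j := by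
  induction j with
  | zero => rfl
  | succ j ih => show (r.lift j).q + 1 = _; omega

lemma Rep.mk_succ {X Y : Stab S} (r : Rep X Y) : r.succ.mk' = r.mk' :=
  (Quot.sound (r := fun r r' : Rep X Y => r' = r.succ) rfl).symm

lemma Rep.mk_lift {X Y : Stab S} (r : Rep X Y) (j : ℕ) : (r.lift j).mk' = r.mk' := by
  induction j with
  | zero => rfl
  | succ j ih => exact (r.lift j).mk_succ.trans ih

lemma Rep.succ_lift {X Y : Stab S} (r : Rep X Y) (j : ℕ) : r.succ.lift j = r.lift (j + 1) := by
  induction j with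
  | zero => rfl
  | succ j ih => exact congrArg Rep.succ ih

/-- Composition of representatives whose middle objects match. -/
def Rep.comp {X Y Z : Stab S} (r : Rep X Y) (s : Rep Y Z) (e : r.q = s.p) : Rep X Z where
  p := r.p
  q := s.q
  h := by rw [r.h, ← s.h, e]
  f := r.f ≫ eqToHom (by rw [e]) ≫ s.f

lemma Rep.comp_succ {X Y Z : Stab S} (r : Rep X Y) (s : Rep Y Z) (e : r.q = s.p) :
    (r.comp s e).succ = r.succ.comp s.succ (congrArg (· + 1) e) := by
  refine Rep.ext rfl rfl (heq_of_eq ?_)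
  simp only [Rep.succ, Rep.comp, Functor.map_comp, eqToHom_map]
  rfl

lemma Rep.comp_lift {X Y Z : Stab S} (r : Rep X Y) (s : Rep Y Z) (e : r.q = s.p) (j : ℕ) :
    ((r.lift j).comp (s.lift j) (by rw [lift_p, lift_q, e])).mk' = (r.comp s e).mk' := by
  induction j with
  | zero => rfl
  | succ j ih =>
    rw [← ih]
    exact (congrArg Rep.mk' (Rep.comp_succ _ _ _)).symm.trans (Rep.mk_succ _)

lemma Rep.lift_add {X Y : Stab S} (r : Rep X Y) (a j : ℕ) :
    (r.lift a).lift j = r.lift (a + j) := by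
  induction j with
  | zero => rfl
  | succ j ih => exact congrArg Rep.succ ih

lemma Rep.comp_indep {X Y Z : Stab S} (r : Rep X Y) (s : Rep Y Z) {a b a' b' : ℕ}
    (e : (r.lift a).q = (s.lift b).p) (e' : (r.lift a').q = (s.lift b').p) :
    ((r.lift a).comp (s.lift b) e).mk' = ((r.lift a').comp (s.lift b') e').mk' := by
  wlog hab : a ≤ a' generalizing a b a' b'
  · exact (this e' e (by omega)).symm
  obtain ⟨j, rfl⟩ := Nat.exists_eq_add_of_le hab
  have : b' = b + j := by simp only [lift_p, lift_q] at e e'; omega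
  subst this
  rw [← Rep.comp_lift _ _ e j]
  simp only [Rep.lift_add]

/-- Composition: bring both morphisms to a common stage and compose there. -/
def Hom.comp {X Y Z : Stab S} (x : Hom X Y) (y : Hom Y Z) : Hom X Z :=
  Quot.liftOn₂ x y
    (fun r s => ((r.lift s.p).comp (s.lift r.q)
      (by rw [Rep.lift_q, Rep.lift_p, add_comm])).mk')
    (by
      rintro r s _ rfl
      simp only [Rep.succ_lift]
      exact Rep.comp_indep _ _ _ _)
    (by
      rintro r _ s rfl
      simp only [Rep.succ_lift]
      exact Rep.comp_indep _ _ _ _)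

/-- On representatives with matching middle objects, composition is composition. -/
lemma Hom.comp_mk {X Y Z : Stab S} (r : Rep X Y) (s : Rep Y Z) (e : r.q = s.p) :
    Hom.comp r.mk' s.mk' = (r.comp s e).mk' :=
  Rep.comp_indep r s _ (a' := 0) (b' := 0) e

/-- The representative of the identity at stage `k = n - m`. -/
def Rep.id (X : Stab S) (n : ℕ) : Rep X X := ⟨n, n, rfl, 𝟙 _⟩

lemma Rep.id_succ (X : Stab S) (n : ℕ) : (Rep.id X n).succ = Rep.id X (n + 1) :=
  Rep.ext rfl rfl (heq_of_eq (S.map_id _))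

lemma Rep.mk_id (X : Stab S) (n : ℕ) : (Rep.id X n).mk' = (Rep.id X 0).mk' := by
  induction n with
  | zero => rfl
  | succ n ih => rw [← ih, ← Rep.id_succ, Rep.mk_succ]

lemma Rep.id_comp {X Y : Stab S} (r : Rep X Y) : (Rep.id X r.p).comp r rfl = r :=
  Rep.ext rfl rfl (heq_of_eq (by simp [Rep.id, Rep.comp]))

lemma Rep.comp_id {X Y : Stab S} (r : Rep X Y) : r.comp (Rep.id Y r.q) rfl = r :=
  Rep.ext rfl rfl (heq_of_eq (by simp [Rep.id, Rep.comp]))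

instance : Category.{w} (Stab S) where
  Hom := Hom
  id X := (Rep.id X 0).mk'
  comp := Hom.comp
  id_comp := by
    rintro X Y ⟨r⟩
    show Hom.comp (Rep.id X 0).mk' r.mk' = r.mk'
    rw [← Rep.mk_id X r.p, Hom.comp_mk _ _ rfl, Rep.id_comp]
  comp_id := by
    rintro X Y ⟨r⟩
    show Hom.comp r.mk' (Rep.id Y 0).mk' = r.mk'
    rw [← Rep.mk_id Y r.q, Hom.comp_mk _ _ rfl, Rep.comp_id]
  assoc := by
    rintro X Y Z W ⟨r⟩ ⟨s⟩ ⟨t⟩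
    show Hom.comp (Hom.comp r.mk' s.mk') t.mk' = Hom.comp r.mk' (Hom.comp s.mk' t.mk')
    have e : (r.lift (s.p + t.p)).q = (s.lift (r.q + t.p)).p := by
      rw [Rep.lift_p, Rep.lift_q]; omega
    have e' : (s.lift (r.q + t.p)).q = (t.lift (s.q + r.q)).p := by
      rw [Rep.lift_p, Rep.lift_q]; omega
    rw [← r.mk_lift (s.p + t.p), ← s.mk_lift (r.q + t.p), ← t.mk_lift (s.q + r.q),
      Hom.comp_mk _ _ e, Hom.comp_mk _ _ e', Hom.comp_mk (Rep.comp _ _ e) _ e',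
      Hom.comp_mk _ (Rep.comp _ _ e') e]
    exact congrArg Rep.mk' (Rep.ext rfl rfl (heq_of_eq (by simp [Rep.comp])))

/-- The class of a morphism `f : S^p X ⟶ S^q Y` as a morphism `X_m ⟶ Y_n`, where
`p - m = q - n`. -/
def homMk {X Y : Stab S} (p q : ℕ) (h : (p : ℤ) - X.deg = (q : ℤ) - Y.deg)
    (f : iter S p X.obj ⟶ iter S q Y.obj) : X ⟶ Y :=
  Rep.mk' ⟨p, q, h, f⟩

lemma homMk_comp {X Y Z : Stab S} (p q r : ℕ) (h : (p : ℤ) - X.deg = (q : ℤ) - Y.deg)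
    (h' : (q : ℤ) - Y.deg = (r : ℤ) - Z.deg) (f : iter S p X.obj ⟶ iter S q Y.obj)
    (g : iter S q Y.obj ⟶ iter S r Z.obj) :
    homMk p q h f ≫ homMk q r h' g = homMk p r (h.trans h') (f ≫ g) :=
  (Hom.comp_mk _ _ rfl).trans
    (congrArg Rep.mk' (Rep.ext rfl rfl (heq_of_eq (by simp [Rep.comp]))))

lemma homMk_id (X : Stab S) (n : ℕ) : homMk n n rfl (𝟙 (iter S n X.obj)) = 𝟙 X := Rep.mk_id X n

lemma hom_induction {X Y : Stab S} {P : (X ⟶ Y) → Prop}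
    (hP : ∀ p q h f, P (homMk p q h f)) (x : X ⟶ Y) : P x := by
  obtain ⟨r⟩ := x
  exact hP r.p r.q r.h r.f

variable (S)

/-- The functor `X ↦ X_m`. -/
def incl (m : ℤ) : H ⥤ Stab S where
  obj X := ⟨X, m⟩
  map f := homMk 0 0 rfl f
  map_id X := homMk_id ⟨X, m⟩ 0
  map_comp {X Y Z} f g :=
    (homMk_comp (X := (⟨X, m⟩ : Stab S)) (Y := ⟨Y, m⟩) (Z := ⟨Z, m⟩) 0 0 0 rfl rfl f g).symm

/-- The functor `Σ (X_m) = X_(m+1)`; on morphisms it is the reindexing `k ↦ k - 1`. -/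
def shift : Stab S ⥤ Stab S where
  obj X := ⟨X.obj, X.deg + 1⟩
  map {X Y} x := Quot.map
    (fun r : Rep X Y => (⟨r.p, r.q, by have := r.h; push_cast; linarith, r.f⟩ :
      Rep (⟨X.obj, X.deg + 1⟩ : Stab S) ⟨Y.obj, Y.deg + 1⟩))
    (by rintro r _ rfl; rfl) x
  map_id X := rfl
  map_comp := by
    rintro X Y Z ⟨r⟩ ⟨s⟩
    have e : (r.lift s.p).q = (s.lift r.q).p := by rw [Rep.lift_p, Rep.lift_q, add_comm]
    have hr : (Quot.mk _ r : X ⟶ Y) =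
      homMk (r.lift s.p).p (r.lift s.p).q (r.lift s.p).h (r.lift s.p).f := (r.mk_lift s.p).symm
    have hs : (Quot.mk _ s : Y ⟶ Z) =
      homMk (s.lift r.q).p (s.lift r.q).q (s.lift r.q).h (s.lift r.q).f := (s.mk_lift r.q).symm
    rw [hr, hs]
    generalize r.lift s.p = r' at e
    generalize s.lift r.q = s' at e
    obtain ⟨p, q, h, f⟩ := r'
    obtain ⟨p', q', h', g⟩ := s'
    obtain rfl : q = p' := e
    rw [homMk_comp]
    exact (homMk_comp (X := ⟨X.obj, X.deg + 1⟩) (Y := ⟨Y.obj, Y.deg + 1⟩)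
      (Z := ⟨Z.obj, Z.deg + 1⟩) _ _ _ _ _ f g).symm

/-- The canonical isomorphism `Σ² (X_0) = X_2 ≅ (S² X)_0`, the class of the identity of `S² X`. -/
def doubleShiftIso (X : H) :
    (shift S).obj ((shift S).obj ((incl S 0).obj X)) ≅ (incl S 0).obj (S.obj (S.obj X)) where
  hom := homMk 2 0 rfl (𝟙 (S.obj (S.obj X)))
  inv := homMk 0 2 rfl (𝟙 (S.obj (S.obj X)))
  hom_inv_id := (homMk_comp _ _ _ _ _ _ _).trans
    ((congrArg (homMk 2 2 rfl) (Category.id_comp (𝟙 (S.obj (S.obj X))))).trans (homMk_id _ 2))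
  inv_hom_id := (homMk_comp _ _ _ _ _ _ _).trans
    ((congrArg (homMk 0 0 rfl) (Category.id_comp (𝟙 (S.obj (S.obj X))))).trans (homMk_id _ 0))

end Stab

namespace CStarAlgCat

/-! ### The stable homotopy category and its localisation -/

/-- The homotopy category of C⋆-algebras. -/
abbrev HoCStar : Type (u + 1) := Quotient Homotopic.{u}

/-- The suspension functor on the homotopy category. -/
def hoSusp : HoCStar.{u} ⥤ HoCStar.{u} :=
  CategoryTheory.Quotient.lift _ (suspension ⋙ Quotient.functor Homotopic) fun _ _ _ _ h =>
    CategoryTheory.Quotient.sound _ h.susp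

/-- The stable homotopy category of C⋆-algebras: objects `A_m`, morphisms
`colim_k [Σ^(m+k) A, Σ^(n+k) B]`. -/
abbrev SH : Type (u + 1) := Stab hoSusp.{u}

/-- The functor `A ↦ A_m` from C⋆-algebras to the stable homotopy category. -/
def toSH (m : ℤ) : CStarAlgCat.{u} ⥤ SH.{u} := Quotient.functor Homotopic ⋙ Stab.incl hoSusp m

/-- `I --ι--> A --π--> B` is a split extension of C⋆-algebras: `ι` is injective with image the
kernel of `π`, and `π` has a section that is a `⋆`-homomorphism. -/
structure IsSplitExtension {I A B : CStarAlgCat.{u}} (ι : I ⟶ A) (π : A ⟶ B) : Prop where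
  injective : Function.Injective (Hom.star ι)
  exact : ∀ a : A, Hom.star π a = 0 ↔ ∃ x : I, Hom.star ι x = a
  split : ∃ s : B ⟶ A, s ≫ π = 𝟙 B

/-- The class `X⁰` of inclusions of kernels of split surjections onto contractible algebras. -/
def kernelClass : MorphismProperty CStarAlgCat.{u} := fun _ A ι =>
  ∃ (B : CStarAlgCat.{u}) (π : A ⟶ B), IsSplitExtension ι π ∧ IsContractible B

/-- The class `X` of morphisms of the stable homotopy category generated by the kernel inclusions
in `X⁰`, placed in every degree, and all isomorphisms. -/
inductive stableKernelClass : MorphismProperty SH.{u}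
  | kernel (m : ℤ) {I A : CStarAlgCat.{u}} (ι : I ⟶ A) (hι : kernelClass ι) :
      stableKernelClass ((toSH m).map ι)
  | iso {X Y : SH.{u}} (f : X ⟶ Y) (hf : IsIso f) : stableKernelClass f
  | comp {X Y Z : SH.{u}} (f : X ⟶ Y) (g : Y ⟶ Z) (hf : stableKernelClass f)
      (hg : stableKernelClass g) : stableKernelClass (f ≫ g)

/-- The localisation of the stable homotopy category at `X`. -/
abbrev SHLoc : Type (u + 1) := stableKernelClass.{u}.Localization

/-- The localisation functor. -/
abbrev locFunctor : SH.{u} ⥤ SHLoc.{u} := stableKernelClass.Q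

/-- The canonical functor `A ↦ A_0` from C⋆-algebras to the localised category. -/
def toSHLoc : CStarAlgCat.{u} ⥤ SHLoc.{u} := toSH 0 ⋙ locFunctor

lemma stableKernelClass.shift {X Y : SH.{u}} {f : X ⟶ Y} (hf : stableKernelClass f) :
    stableKernelClass ((Stab.shift hoSusp).map f) := by
  induction hf with
  | kernel m ι hι => exact .kernel (m + 1) ι hι
  | iso f hf => exact .iso _ inferInstance
  | comp f g _ _ hf hg => rw [Functor.map_comp]; exact .comp _ _ hf hg

/-- The suspension functor of the localised category, induced by `A_m ↦ A_(m+1)`. -/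
def locSusp : SHLoc.{u} ⥤ SHLoc.{u} :=
  Localization.Construction.lift (Stab.shift hoSusp ⋙ locFunctor) fun _ _ _ hf =>
    MorphismProperty.Q_inverts _ _ hf.shift

/-- The canonical isomorphism `Σ² (A_0) = A_2 ≅ (Σ² A)_0` in the localised category. -/
def locDoubleSuspIso (A : CStarAlgCat.{u}) :
    locSusp.obj (locSusp.obj (toSHLoc.obj A)) ≅ toSHLoc.obj (susp (susp A)) :=
  locFunctor.mapIso (Stab.doubleShiftIso hoSusp ((Quotient.functor _).obj A))

/-- A preadditive structure on the stable homotopy category whose addition is induced by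
concatenation: `[f] + [g] = [f * g]` for all homomorphisms `f, g : Σ^p A → Σ(Σ^q B)`. -/
def IsConcatAddition (P : Preadditive SH.{u}) : Prop :=
  ∀ (X Y : SH.{u}) (p q : ℕ) (h : (p : ℤ) - X.deg = ((q + 1 : ℕ) : ℤ) - Y.deg)
    (f g : (iter hoSusp p X.obj).as ⟶ susp (iter hoSusp q Y.obj).as),
    letI := P
    (Stab.homMk p (q + 1) h ((Quotient.functor Homotopic).map f) : X ⟶ Y) +
      Stab.homMk p (q + 1) h ((Quotient.functor Homotopic).map g) =
    Stab.homMk p (q + 1) h ((Quotient.functor Homotopic).map (concat f g))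

/-! ### Split exact, homotopy invariant and Bott periodic functors -/

/-- A functor on C⋆-algebras is homotopy invariant if it identifies homotopic homomorphisms. -/
def IsHomotopyInvariant {𝒜 : Type v} [Category.{w} 𝒜] (F : CStarAlgCat.{u} ⥤ 𝒜) : Prop :=
  ∀ ⦃A B : CStarAlgCat.{u}⦄ (f g : A ⟶ B), Homotopic f g → F.map f = F.map g

/-- A functor is split exact if it maps split extensions `I → A → B` to split short exact sequences
`0 → F I → F A → F B → 0`. -/
def IsSplitExact {𝒜 : Type v} [Category.{w} 𝒜] [Preadditive 𝒜] (F : CStarAlgCat.{u} ⥤ 𝒜) : Prop :=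
  ∀ ⦃I A B : CStarAlgCat.{u}⦄ (ι : I ⟶ A) (π : A ⟶ B), IsSplitExtension ι π →
    ∃ w : F.map ι ≫ F.map π = 0, Nonempty (ShortComplex.mk (F.map ι) (F.map π) w).Splitting

/-- A contravariant functor is split exact if it maps split extensions `I → A → B` to split short
exact sequences `0 → F B → F A → F I → 0`. -/
def IsSplitExactOp {𝒜 : Type v} [Category.{w} 𝒜] [Preadditive 𝒜] (F : CStarAlgCat.{u}ᵒᵖ ⥤ 𝒜) :
    Prop :=
  ∀ ⦃I A B : CStarAlgCat.{u}⦄ (ι : I ⟶ A) (π : A ⟶ B), IsSplitExtension ι π →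
    ∃ w : F.map π.op ≫ F.map ι.op = 0,
      Nonempty (ShortComplex.mk (F.map π.op) (F.map ι.op) w).Splitting

/-- A Bott periodic functor on C⋆-algebras is a functor with a natural isomorphism
`F A ≅ F (Σ² A)`. -/
abbrev BottIso {𝒜 : Type v} [Category.{w} 𝒜] (F : CStarAlgCat.{u} ⥤ 𝒜) :=
  F ≅ suspension ⋙ suspension ⋙ F

/-- A factorisation of a Bott periodic functor `(F, β)` through the localised category: a functor
`G` with a periodicity isomorphism `G ≅ G ∘ Σ²` and a natural isomorphism `F A ≅ G (A_0)` under
which the two periodicity isomorphisms correspond. -/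
structure BottFactorization {𝒜 : Type v} [Category.{w} 𝒜] (F : CStarAlgCat.{u} ⥤ 𝒜)
    (β : BottIso F) where
  functor : SHLoc.{u} ⥤ 𝒜
  bott : functor ≅ locSusp ⋙ locSusp ⋙ functor
  iso : F ≅ toSHLoc ⋙ functor
  compat : ∀ A : CStarAlgCat.{u},
    β.hom.app A ≫ iso.hom.app (susp (susp A)) =
      iso.hom.app A ≫ bott.hom.app (toSHLoc.obj A) ≫ functor.map (locDoubleSuspIso A).hom

/-- An isomorphism of factorisations: a natural isomorphism respecting the identifications with `F`
and the periodicity isomorphisms. -/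
structure BottFactorization.IsCompatible {𝒜 : Type v} [Category.{w} 𝒜] {F : CStarAlgCat.{u} ⥤ 𝒜}
    {β : BottIso F} (G G' : BottFactorization F β) (θ : G.functor ≅ G'.functor) : Prop where
  iso : ∀ A : CStarAlgCat.{u}, G.iso.hom.app A ≫ θ.hom.app (toSHLoc.obj A) = G'.iso.hom.app A
  bott : ∀ Z : SHLoc.{u}, G.bott.hom.app Z ≫ θ.hom.app (locSusp.obj (locSusp.obj Z)) =
    θ.hom.app Z ≫ G'.bott.hom.app Z

end CStarAlgCat

end

noncomputable section

namespace CStarAlgCat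

variable {A B C D E : CStarAlgCat.{u}}

/-! ### Loops and reparametrisation -/

/-! Addition. Double loops can be concatenated in two coordinates; the two operations satisfy a
strict interchange law and share the zero map as unit up to homotopy. Eckmann–Hilton
(`concat_homotopic_concat'`) makes them agree and be commutative and associative. Every stable
morphism has a representative into a double suspension, so `SH` becomes preadditive. Direct sums are
biproducts there (`toSH_total`), and the class `X` is closed under them
(`stableKernelClass.biprod_map`). Hence localisation preserves binary products, and sums of
morphisms can be formed through the image of a biproduct.

Split exactness (`isSplitExact_suspension_comp`). Given a split extension with section `s`, let `κ`
be the concatenation of the identity of `ΣA` with the reverse of `Σ(sπ)`. Its image in `ΣB` is a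
loop followed by its own reverse, hence symmetric under `t ↦ 1 - t`. So `κ` takes values in the
algebra of loops with symmetric image in `ΣB`. Symmetric loops are contractible, so the inclusion of
`ΣI` into that algebra is a kernel inclusion that gets inverted. Inverting it after `κ` gives a
retraction `r` of `Σι`, and `r` followed by `Σι` is the class of `κ`, namely `1 - Σ(sπ)`. Since `A_0
≅ (ΣA)_(-1)`, the suspension does no harm.

Universal property. A split exact homotopy invariant functor kills contractible algebras, so it
inverts the kernel inclusions. Put `F̃(A_m) = F(Σ^|m| A)`: the parity of `|m|` is that of `m`, and
`β` or its inverse supplies the missing identifications (`exists_bottFactorization`). A comparison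
of two factorisations is forced in degree `0` by the identifications with `F`, in positive degrees
by `(ΣA)_m ≅ A_(m+1)`, and in negative degrees by periodicity. What must be checked is that these
prescriptions agree (`Stab.exists_bott_iso`). -/

lemma hom_ext {f g : A ⟶ B} (h : ∀ a, Hom.star f a = Hom.star g a) : f = g :=
  NonUnitalStarAlgHom.ext h

@[simp] lemma star_comp_apply (f : A ⟶ B) (g : B ⟶ C) (a : A) :
    Hom.star (f ≫ g) a = Hom.star g (Hom.star f a) := rfl

@[simp] lemma star_id_apply (a : A) : Hom.star (𝟙 A) a = a := rfl

@[simp] lemma star_zeroHom_apply (a : A) : Hom.star (zeroHom A B) a = 0 := rfl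

@[simp] lemma zeroHom_comp (f : B ⟶ C) : zeroHom A B ≫ f = zeroHom A C :=
  hom_ext fun _ => map_zero (Hom.star f)

@[simp] lemma comp_zeroHom (f : A ⟶ B) : f ≫ zeroHom B C = zeroHom A C := rfl

/-- The value of a loop at a parameter. -/
def ev (x : susp A) (t : unitInterval) : A := Subtype.val (p := (· ∈ loops A)) x t

lemma ev_ext {x y : susp A} (h : ∀ t, ev x t = ev y t) : x = y :=
  Subtype.ext (ContinuousMap.ext h)

lemma loop_hom_ext {f g : A ⟶ susp B} (h : ∀ a t, ev (Hom.star f a) t = ev (Hom.star g a) t) :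
    f = g :=
  hom_ext fun a => ev_ext (h a)

lemma continuous_ev (x : susp A) : Continuous (ev x) :=
  ContinuousMap.continuous (Subtype.val (p := (· ∈ loops A)) x)

@[simp] lemma ev_at_zero (x : susp A) : ev x 0 = 0 := (Subtype.property (p := (· ∈ loops A)) x).1

@[simp] lemma ev_at_one (x : susp A) : ev x 1 = 0 := (Subtype.property (p := (· ∈ loops A)) x).2

@[simp] lemma ev_zero (t : unitInterval) : ev (0 : susp A) t = 0 := rfl

@[simp] lemma ev_suspMap (f : A ⟶ B) (x : susp A) (t : unitInterval) :
    ev (Hom.star (suspMap f) x) t = Hom.star f (ev x t) := rfl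

@[simp] lemma ev_concat (f g : A ⟶ susp B) (a : A) (t : unitInterval) :
    ev (Hom.star (concat f g) a) t =
      ev (Hom.star f a) (firstHalf t) + ev (Hom.star g a) (secondHalf t) := rfl

lemma suspMap_id (A : CStarAlgCat.{u}) : suspMap (𝟙 A) = 𝟙 (susp A) := rfl

lemma suspMap_comp (f : A ⟶ B) (g : B ⟶ C) : suspMap (f ≫ g) = suspMap f ≫ suspMap g := rfl

lemma suspMap_zeroHom : suspMap (zeroHom A B) = zeroHom (susp A) (susp B) := rfl

/-- A self-map of the interval that maps the endpoints to endpoints. -/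
def MapsEnds (φ : C(unitInterval, unitInterval)) : Prop :=
  (φ 0 = 0 ∨ φ 0 = 1) ∧ (φ 1 = 0 ∨ φ 1 = 1)

lemma MapsEnds.ev_zero {φ : C(unitInterval, unitInterval)} (hφ : MapsEnds φ) (x : susp A) :
    ev x (φ 0) = 0 := by
  rcases hφ.1 with h | h <;> simp [h]

lemma MapsEnds.ev_one {φ : C(unitInterval, unitInterval)} (hφ : MapsEnds φ) (x : susp A) :
    ev x (φ 1) = 0 := by
  rcases hφ.2 with h | h <;> simp [h]

/-- Reparametrisation of loops. -/
def reparam (A : CStarAlgCat.{u}) (φ : C(unitInterval, unitInterval)) (hφ : MapsEnds φ) :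
    susp A ⟶ susp A := ofStar
  { toFun := fun x => (⟨⟨fun t => ev x (φ t), (continuous_ev x).comp φ.continuous⟩,
      hφ.ev_zero x, hφ.ev_one x⟩ : loops A)
    map_smul' := fun _ _ => rfl
    map_zero' := rfl
    map_add' := fun _ _ => rfl
    map_mul' := fun _ _ => rfl
    map_star' := fun _ => rfl }

@[simp] lemma ev_reparam (φ : C(unitInterval, unitInterval)) (hφ : MapsEnds φ) (x : susp A)
    (t : unitInterval) : ev (Hom.star (reparam A φ hφ) x) t = ev x (φ t) := rfl

lemma reparam_comp_suspMap (φ : C(unitInterval, unitInterval)) (hφ : MapsEnds φ) (f : A ⟶ B) :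
    reparam A φ hφ ≫ suspMap f = suspMap f ≫ reparam B φ hφ := rfl

/-- The straight line between two points of the interval. -/
def line (t x y : unitInterval) : unitInterval :=
  ⟨(1 - (t : ℝ)) * x + t * y, by
    have ht := t.2; have hx := x.2; have hy := y.2
    exact convex_Icc (0 : ℝ) 1 hx hy (by linarith [ht.2]) ht.1 (by ring)⟩

@[simp] lemma line_zero (x y : unitInterval) : line 0 x y = x := Subtype.ext (by simp [line])

@[simp] lemma line_one (x y : unitInterval) : line 1 x y = y := Subtype.ext (by simp [line])

@[simp] lemma line_self (t x : unitInterval) : line t x x = x := Subtype.ext (by simp [line]; ring)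

/-- The straight line homotopy between self-maps of the interval. -/
def linePath (φ ψ : C(unitInterval, unitInterval)) (t : unitInterval) :
    C(unitInterval, unitInterval) :=
  ⟨fun x => line t (φ x) (ψ x), by unfold line; fun_prop⟩

lemma continuous_linePath (φ ψ : C(unitInterval, unitInterval)) :
    Continuous fun p : unitInterval × unitInterval => linePath φ ψ p.1 p.2 := by
  simp only [linePath, line, ContinuousMap.coe_mk]; fun_prop

/-- Agreement at the endpoints is essential: otherwise the line would move an endpoint through the
interior, where a loop need not vanish. -/
lemma MapsEnds.linePath {φ ψ : C(unitInterval, unitInterval)} (hφ : MapsEnds φ)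
    (h0 : φ 0 = ψ 0) (h1 : φ 1 = ψ 1) (t : unitInterval) :
    MapsEnds (CStarAlgCat.linePath φ ψ t) := by
  simpa [MapsEnds, CStarAlgCat.linePath, ← h0, ← h1] using hφ

/-- A path of homomorphisms into a suspension is continuous if it is jointly continuous in both
parameters. -/
lemma continuous_path_susp (h : unitInterval → (A ⟶ susp B)) (a : A)
    (hc : Continuous fun p : unitInterval × unitInterval => ev (Hom.star (h p.1) a) p.2) :
    Continuous fun t => Hom.star (h t) a :=
  Continuous.subtype_mk (p := (· ∈ loops B)) (ContinuousMap.curry ⟨_, hc⟩).continuous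
    fun t => Subtype.property (p := (· ∈ loops B)) (Hom.star (h t) a)

lemma continuous_reparam_path (φ ψ : C(unitInterval, unitInterval)) (hφ : MapsEnds φ)
    (h0 : φ 0 = ψ 0) (h1 : φ 1 = ψ 1) (x : susp A) :
    Continuous fun t => Hom.star (reparam A (linePath φ ψ t) (hφ.linePath h0 h1 t)) x :=
  continuous_path_susp (fun t => reparam A (linePath φ ψ t) (hφ.linePath h0 h1 t)) x
    ((continuous_ev x).comp (continuous_linePath φ ψ))

/-- Convexity of the interval. The unit and inverse laws of concatenation are instances. -/
lemma reparam_homotopic {φ ψ : C(unitInterval, unitInterval)} (hφ : MapsEnds φ)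
    (hψ : MapsEnds ψ) (h0 : φ 0 = ψ 0) (h1 : φ 1 = ψ 1) :
    Homotopic (reparam A φ hφ) (reparam A ψ hψ) := by
  refine ⟨fun t => reparam A (linePath φ ψ t) (hφ.linePath h0 h1 t),
    continuous_reparam_path φ ψ hφ h0 h1, ?_, ?_⟩
  all_goals exact loop_hom_ext fun x t => by simp [linePath]

lemma Homotopic.refl (f : A ⟶ B) : Homotopic f f := (Congruence.equivalence (r := Homotopic)).refl f

lemma Homotopic.symm {f g : A ⟶ B} (h : Homotopic f g) : Homotopic g f :=
  (Congruence.equivalence (r := Homotopic)).symm h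

lemma Homotopic.trans {f g k : A ⟶ B} (h : Homotopic f g) (h' : Homotopic g k) : Homotopic f k :=
  (Congruence.equivalence (r := Homotopic)).trans h h'

lemma Homotopic.comp_left (f : A ⟶ B) {g g' : B ⟶ C} (h : Homotopic g g') :
    Homotopic (f ≫ g) (f ≫ g') := HomRel.IsStableUnderPrecomp.comp_left _ h

lemma Homotopic.comp_right {f f' : A ⟶ B} (g : B ⟶ C) (h : Homotopic f f') :
    Homotopic (f ≫ g) (f' ≫ g) := HomRel.IsStableUnderPostcomp.comp_right _ h

lemma Homotopic.concat {f f' g g' : A ⟶ CStarAlgCat.susp B} (h : Homotopic f f')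
    (h' : Homotopic g g') : Homotopic (CStarAlgCat.concat f g) (CStarAlgCat.concat f' g') := by
  obtain ⟨k, hk, rfl, rfl⟩ := h
  obtain ⟨k', hk', rfl, rfl⟩ := h'
  refine ⟨fun t => CStarAlgCat.concat (k t) (k' t), fun a => ?_, rfl, rfl⟩
  refine continuous_path_susp _ a ?_
  -- Evaluation `C([0,1], B) × [0,1] → B` is continuous, so a continuous path of loops is jointly
  -- continuous and may be reparametrised in the loop variable.
  have key : ∀ k : unitInterval → (A ⟶ CStarAlgCat.susp B),
      Continuous (fun t => Hom.star (k t) a) →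
      Continuous fun p : unitInterval × unitInterval => ev (Hom.star (k p.1) a) p.2 := by
    intro k hk
    have h1 : Continuous fun t => Subtype.val (p := (· ∈ loops B)) (Hom.star (k t) a) :=
      continuous_subtype_val.comp hk
    exact ContinuousEval.continuous_eval.comp ((h1.comp continuous_fst).prodMk continuous_snd)
  exact ((key k (hk a)).comp (continuous_fst.prodMk (firstHalf.continuous.comp continuous_snd))).add
    ((key k' (hk' a)).comp (continuous_fst.prodMk (secondHalf.continuous.comp continuous_snd)))

@[simp] lemma firstHalf_zero : firstHalf 0 = 0 := by simp [firstHalf]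
@[simp] lemma firstHalf_one : firstHalf 1 = 1 :=
  Set.projIcc_of_right_le zero_le_one (by norm_num)
@[simp] lemma secondHalf_zero : secondHalf 0 = 0 :=
  Set.projIcc_of_le_left zero_le_one (by norm_num)
@[simp] lemma secondHalf_one : secondHalf 1 = 1 :=
  Set.projIcc_of_right_le zero_le_one (by norm_num)

lemma mapsEnds_firstHalf : MapsEnds firstHalf := by simp [MapsEnds]
lemma mapsEnds_secondHalf : MapsEnds secondHalf := by simp [MapsEnds]
lemma mapsEnds_id : MapsEnds (ContinuousMap.id _) := by simp [MapsEnds]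

/-- The reversal of the interval. -/
def flipMap : C(unitInterval, unitInterval) := ⟨unitInterval.symm, unitInterval.continuous_symm⟩

@[simp] lemma flipMap_apply (t : unitInterval) : flipMap t = unitInterval.symm t := rfl

lemma mapsEnds_flipMap : MapsEnds flipMap := by simp [MapsEnds]

/-! ### Concatenation as a group law up to homotopy -/

lemma concat_comp_suspMap (f g : A ⟶ susp B) (k : B ⟶ C) :
    concat f g ≫ suspMap k = concat (f ≫ suspMap k) (g ≫ suspMap k) :=
  loop_hom_ext fun _ _ => map_add (Hom.star k) _ _

lemma comp_concat (k : A ⟶ B) (f g : B ⟶ susp C) :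
    k ≫ concat f g = concat (k ≫ f) (k ≫ g) := rfl

lemma concat_zeroHom (f : A ⟶ susp B) :
    concat f (zeroHom A (susp B)) = f ≫ reparam B firstHalf mapsEnds_firstHalf :=
  loop_hom_ext fun _ _ => by simp

lemma zeroHom_concat (f : A ⟶ susp B) :
    concat (zeroHom A (susp B)) f = f ≫ reparam B secondHalf mapsEnds_secondHalf :=
  loop_hom_ext fun _ _ => by simp

lemma reparam_firstHalf_homotopic :
    Homotopic (reparam A firstHalf mapsEnds_firstHalf) (𝟙 (susp A)) :=
  reparam_homotopic mapsEnds_firstHalf mapsEnds_id (by simp) (by simp)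

lemma reparam_secondHalf_homotopic :
    Homotopic (reparam A secondHalf mapsEnds_secondHalf) (𝟙 (susp A)) :=
  reparam_homotopic mapsEnds_secondHalf mapsEnds_id (by simp) (by simp)

lemma concat_zeroHom_homotopic (f : A ⟶ susp B) :
    Homotopic (concat f (zeroHom A (susp B))) f := by
  rw [concat_zeroHom]; exact reparam_firstHalf_homotopic.comp_left f

lemma zeroHom_concat_homotopic (f : A ⟶ susp B) :
    Homotopic (concat (zeroHom A (susp B)) f) f := by
  rw [zeroHom_concat]; exact reparam_secondHalf_homotopic.comp_left f

/-- The reversal of loops. -/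
def rev (A : CStarAlgCat.{u}) : susp A ⟶ susp A := reparam A flipMap mapsEnds_flipMap

@[simp] lemma ev_rev (x : susp A) (t : unitInterval) :
    ev (Hom.star (rev A) x) t = ev x (unitInterval.symm t) := rfl

lemma rev_comp_suspMap (f : A ⟶ B) : rev A ≫ suspMap f = suspMap f ≫ rev B := rfl

lemma rev_rev (A : CStarAlgCat.{u}) : rev A ≫ rev A = 𝟙 (susp A) :=
  loop_hom_ext fun _ _ => by simp

/-- The tent map `t ↦ min (2t) (2 - 2t)`. -/
def tent : C(unitInterval, unitInterval) :=
  ⟨fun t => Set.projIcc 0 1 zero_le_one (min (2 * (t : ℝ)) (2 - 2 * t)),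
    continuous_projIcc.comp (by fun_prop)⟩

@[simp] lemma tent_zero : tent 0 = 0 := by simp [tent]
@[simp] lemma tent_one : tent 1 = 0 := by simp [tent]

lemma mapsEnds_tent : MapsEnds tent := by simp [MapsEnds]

lemma tent_symm (t : unitInterval) : tent (unitInterval.symm t) = tent t := by
  simp only [tent, ContinuousMap.coe_mk, unitInterval.coe_symm_eq]
  congr 1
  rw [min_comm]; congr 1 <;> ring

/-- A loop followed by its reverse runs out and back along one path, so a single reparametrisation
describes it. The symmetry of the tent is what split exactness rests on later. -/
lemma concat_rev (f : A ⟶ susp B) :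
    concat f (f ≫ rev B) = f ≫ reparam B tent mapsEnds_tent := by
  refine loop_hom_ext fun a t => ?_
  simp only [ev_concat, star_comp_apply, ev_rev, ev_reparam]
  rcases le_total (t : ℝ) (1 / 2) with h | h
  · have h2 : secondHalf t = 0 := Set.projIcc_of_le_left zero_le_one (by linarith)
    have h1 : tent t = firstHalf t := by
      simp only [tent, firstHalf, ContinuousMap.coe_mk]
      rw [min_eq_left (by linarith)]
    simp [h1, h2]
  · have h2 : firstHalf t = 1 := Set.projIcc_of_right_le zero_le_one (by linarith)
    have h1 : tent t = unitInterval.symm (secondHalf t) := by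
      have ht := t.2
      simp only [tent, secondHalf, ContinuousMap.coe_mk]
      rw [min_eq_right (by linarith),
        Set.projIcc_of_mem zero_le_one (x := 2 - 2 * (t : ℝ)) ⟨by linarith [ht.2], by linarith⟩,
        Set.projIcc_of_mem zero_le_one (x := 2 * (t : ℝ) - 1) ⟨by linarith, by linarith [ht.2]⟩]
      exact Subtype.ext (by simp; ring)
    simp [h1, h2]

/-- Both ends of the tent are `0`, so it contracts to the constant `0` with fixed ends, and loops
vanish there. -/
lemma reparam_tent_homotopic :
    Homotopic (reparam A tent mapsEnds_tent) (zeroHom (susp A) (susp A)) := by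
  have h0 : MapsEnds (ContinuousMap.const unitInterval 0) := by simp [MapsEnds]
  have : zeroHom (susp A) (susp A) = reparam A (ContinuousMap.const _ 0) h0 :=
    loop_hom_ext fun _ _ => by simp
  rw [this]
  exact reparam_homotopic mapsEnds_tent h0 (by simp) (by simp)

lemma concat_rev_homotopic (f : A ⟶ susp B) :
    Homotopic (concat f (f ≫ rev B)) (zeroHom A (susp B)) := by
  rw [concat_rev]; exact reparam_tent_homotopic.comp_left f

lemma rev_concat_homotopic (f : A ⟶ susp B) :
    Homotopic (concat (f ≫ rev B) f) (zeroHom A (susp B)) := by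
  simpa [Category.assoc, rev_rev] using concat_rev_homotopic (f ≫ rev B)

/-! ### The two concatenations of double loops -/

/-- The exchange of the two coordinates of a double loop. -/
def swap (A : CStarAlgCat.{u}) : susp (susp A) ⟶ susp (susp A) := ofStar
  { toFun := fun x =>
      have hc : Continuous fun p : unitInterval × unitInterval => ev (ev x p.2) p.1 := by
        have h1 : Continuous fun t => Subtype.val (p := (· ∈ loops A)) (ev x t) :=
          continuous_subtype_val.comp (continuous_ev x)
        exact ContinuousEval.continuous_eval.comp ((h1.comp continuous_snd).prodMk continuous_fst)
      have hm : ∀ s, ContinuousMap.curry ⟨_, hc⟩ s ∈ loops A := fun s =>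
        ⟨show ev (ev x 0) s = 0 by simp, show ev (ev x 1) s = 0 by simp⟩
      (⟨⟨fun s => (⟨_, hm s⟩ : loops A),
        Continuous.subtype_mk (ContinuousMap.curry ⟨_, hc⟩).continuous hm⟩,
        Subtype.ext (ContinuousMap.ext fun t => show ev (ev x t) 0 = 0 by simp),
        Subtype.ext (ContinuousMap.ext fun t => show ev (ev x t) 1 = 0 by simp)⟩ : loops (susp A))
    map_smul' := fun _ _ => rfl
    map_zero' := rfl
    map_add' := fun _ _ => rfl
    map_mul' := fun _ _ => rfl
    map_star' := fun _ => rfl }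

@[simp] lemma ev_ev_swap (x : susp (susp A)) (s t : unitInterval) :
    ev (ev (Hom.star (swap A) x) s) t = ev (ev x t) s := rfl

lemma double_loop_hom_ext {f g : A ⟶ susp (susp B)}
    (h : ∀ a s t, ev (ev (Hom.star f a) s) t = ev (ev (Hom.star g a) s) t) : f = g :=
  loop_hom_ext fun a s => ev_ext (h a s)

lemma swap_swap (A : CStarAlgCat.{u}) : swap A ≫ swap A = 𝟙 _ :=
  double_loop_hom_ext fun _ _ _ => rfl

@[simp] lemma ev_add (x y : susp A) (t : unitInterval) : ev (x + y) t = ev x t + ev y t := rfl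

/-- The concatenation of double loops in the inner coordinate. -/
def concat' (f g : A ⟶ susp (susp B)) : A ⟶ susp (susp B) :=
  concat (f ≫ swap B) (g ≫ swap B) ≫ swap B

@[simp] lemma ev_ev_concat' (f g : A ⟶ susp (susp B)) (a : A) (s t : unitInterval) :
    ev (ev (Hom.star (concat' f g) a) s) t =
      ev (ev (Hom.star f a) s) (firstHalf t) + ev (ev (Hom.star g a) s) (secondHalf t) := rfl

lemma Homotopic.concat' {f f' g g' : A ⟶ CStarAlgCat.susp (CStarAlgCat.susp B)}
    (h : Homotopic f f') (h' : Homotopic g g') :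
    Homotopic (CStarAlgCat.concat' f g) (CStarAlgCat.concat' f' g') :=
  ((h.comp_right _).concat (h'.comp_right _)).comp_right _

lemma concat'_zeroHom_homotopic (f : A ⟶ susp (susp B)) :
    Homotopic (concat' f (zeroHom _ _)) f := by
  have := (concat_zeroHom_homotopic (f ≫ swap B)).comp_right (swap B)
  rwa [Category.assoc, swap_swap, Category.comp_id] at this

lemma zeroHom_concat'_homotopic (f : A ⟶ susp (susp B)) :
    Homotopic (concat' (zeroHom _ _) f) f := by
  have := (zeroHom_concat_homotopic (f ≫ swap B)).comp_right (swap B)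
  rwa [Category.assoc, swap_swap, Category.comp_id] at this

/-- The interchange law. It is strict because both sides are the same four terms, added in a
different order. -/
lemma concat_concat' (f g h k : A ⟶ susp (susp B)) :
    concat (concat' f g) (concat' h k) = concat' (concat f h) (concat g k) :=
  double_loop_hom_ext fun _ _ _ => by simp; abel

/-- Suspending adds a new outer coordinate, which leaves the concatenation in the inner one.
Comparing the two concatenations is therefore what makes addition survive stabilisation. -/
lemma suspMap_concat (f g : A ⟶ susp B) :
    suspMap (concat f g) = concat' (suspMap f) (suspMap g) :=
  double_loop_hom_ext fun _ _ _ => rfl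

/-- Eckmann–Hilton: write `f` as `f *' 0` and `g` as `0 *' g`, interchange, and drop the zeros. -/
lemma concat_homotopic_concat' (f g : A ⟶ susp (susp B)) :
    Homotopic (concat f g) (concat' f g) := by
  have h1 := (concat'_zeroHom_homotopic f).concat (zeroHom_concat'_homotopic g)
  rw [concat_concat'] at h1
  exact h1.symm.trans ((concat_zeroHom_homotopic f).concat' (zeroHom_concat_homotopic g))

/-- The same argument with the zeros on the other sides. -/
lemma concat_comm_homotopic (f g : A ⟶ susp (susp B)) :
    Homotopic (concat f g) (concat g f) := by
  have h1 := (zeroHom_concat'_homotopic f).concat (concat'_zeroHom_homotopic g)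
  rw [concat_concat'] at h1
  exact h1.symm.trans (((zeroHom_concat_homotopic g).concat'
    (concat_zeroHom_homotopic f)).trans (concat_homotopic_concat' g f).symm)

/-- Interchange applied to `(f *' g) * (0 *' h)` regroups the terms, so no reparametrisation of
three loops is needed. Double suspensions suffice, since stable morphisms can always be represented
there. -/
lemma concat_assoc_homotopic (f g h : A ⟶ susp (susp B)) :
    Homotopic (concat (concat f g) h) (concat f (concat g h)) := by
  have h1 := (concat_homotopic_concat' f g).concat (zeroHom_concat'_homotopic h).symm
  rw [concat_concat'] at h1
  exact h1.trans (((concat_zeroHom_homotopic f).concat' (Homotopic.refl _)).trans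
    (concat_homotopic_concat' _ _).symm)

end CStarAlgCat

namespace CStarAlgCat

variable {A B C D E I : CStarAlgCat.{u}}

/-! ### Equalizers -/

instance (f g : A ⟶ B) : IsClosed
    (NonUnitalStarAlgHom.equalizer (Hom.star f) (Hom.star g) : Set A) :=
  isClosed_eq (continuous_star f) (continuous_star g)

/-- The equalizer of two homomorphisms. -/
def eqAlg (f g : A ⟶ B) : CStarAlgCat.{u} where
  carrier := NonUnitalStarAlgHom.equalizer (Hom.star f) (Hom.star g)

/-- The inclusion of an equalizer. -/
def eqIncl (f g : A ⟶ B) : eqAlg f g ⟶ A :=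
  ofStar (NonUnitalStarSubalgebraClass.subtype
    (NonUnitalStarAlgHom.equalizer (Hom.star f) (Hom.star g)))

lemma eqIncl_injective (f g : A ⟶ B) : Function.Injective (Hom.star (eqIncl f g)) :=
  Subtype.val_injective

lemma eqIncl_condition (f g : A ⟶ B) : eqIncl f g ≫ f = eqIncl f g ≫ g :=
  hom_ext fun x => x.2

/-- The homomorphism into an equalizer. -/
def eqLift {f g : A ⟶ B} (k : C ⟶ A) (h : k ≫ f = k ≫ g) : C ⟶ eqAlg f g :=
  ofStar (NonUnitalStarAlgHom.codRestrict (Hom.star k)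
    (NonUnitalStarAlgHom.equalizer (Hom.star f) (Hom.star g))
    fun c => DFunLike.congr_fun (congrArg Hom.star h) c)

@[simp] lemma eqLift_eqIncl {f g : A ⟶ B} (k : C ⟶ A) (h : k ≫ f = k ≫ g) :
    eqLift k h ≫ eqIncl f g = k := rfl

lemma eqIncl_cancel {f g : A ⟶ B} {k k' : C ⟶ eqAlg f g}
    (h : k ≫ eqIncl f g = k' ≫ eqIncl f g) : k = k' :=
  hom_ext fun c => eqIncl_injective f g (DFunLike.congr_fun (congrArg Hom.star h) c)

lemma eqLift_homotopic {f g : A ⟶ B} (k : unitInterval → (C ⟶ A))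
    (hc : ∀ c, Continuous fun t => Hom.star (k t) c) (h : ∀ t, k t ≫ f = k t ≫ g) :
    Homotopic (eqLift (k 0) (h 0)) (eqLift (k 1) (h 1)) :=
  ⟨fun t => eqLift (k t) (h t), fun c => Continuous.subtype_mk (hc c) _, rfl, rfl⟩

/-! ### Suspension of split extensions -/

lemma IsSplitExtension.comp_eq_zero {ι : I ⟶ A} {π : A ⟶ B} (h : IsSplitExtension ι π) :
    ι ≫ π = zeroHom I B :=
  hom_ext fun x => (h.exact _).2 ⟨x, rfl⟩

lemma IsSplitExtension.susp {ι : I ⟶ A} {π : A ⟶ B} (h : IsSplitExtension ι π) :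
    IsSplitExtension (suspMap ι) (suspMap π) where
  injective x y hxy := ev_ext fun t => h.injective
    (by simpa using congrArg (fun z => ev z t) hxy)
  exact a := by
    constructor
    · intro ha
      have h1 : ∀ t, ∃ x : I, Hom.star ι x = ev a t := fun t =>
        (h.exact _).1 (by simpa using congrArg (fun z => ev z t) ha)
      choose x hx using h1
      -- An injective `⋆`-homomorphism is isometric, so pointwise preimages of a continuous loop
      -- form a continuous loop.
      have hc : Continuous x := by
        have hi : Isometry (Hom.star ι) := NonUnitalStarAlgHom.isometry (Hom.star ι) h.injective
        rw [hi.isEmbedding.continuous_iff]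
        exact (continuous_ev a).congr fun t => (hx t).symm
      have h0 : x 0 = 0 := h.injective (by rw [map_zero, hx, ev_at_zero])
      have h1 : x 1 = 0 := h.injective (by rw [map_zero, hx, ev_at_one])
      exact ⟨(⟨⟨x, hc⟩, h0, h1⟩ : loops I), ev_ext hx⟩
    · rintro ⟨x, rfl⟩
      rw [← star_comp_apply, ← suspMap_comp, h.comp_eq_zero]
      rfl
  split := by
    obtain ⟨s, hs⟩ := h.split
    exact ⟨suspMap s, by rw [← suspMap_comp, hs, suspMap_id]⟩

lemma IsContractible.susp (h : IsContractible A) : IsContractible (susp A) :=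
  Homotopic.susp h

lemma kernelClass.susp {ι : I ⟶ A} (h : kernelClass ι) : kernelClass (suspMap ι) := by
  obtain ⟨B, π, hs, hc⟩ := h
  exact ⟨_, _, hs.susp, hc.susp⟩

/-! ### Symmetric loops -/

/-- The algebra of loops with `f (1 - t) = f t`. -/
abbrev symLoops (B : CStarAlgCat.{u}) : CStarAlgCat.{u} := eqAlg (𝟙 (susp B)) (rev B)

/-- The fold map `t ↦ min t (1 - t)`. -/
def fold : C(unitInterval, unitInterval) :=
  ⟨fun t => min t (unitInterval.symm t), by fun_prop⟩

/-- A symmetric loop is determined by its first half: it equals its own reparametrisation by `fold`.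
Scaling `fold` to `0` keeps the loop symmetric throughout. -/
lemma symLoops_contractible (B : CStarAlgCat.{u}) : IsContractible (symLoops B) := by
  have hf : MapsEnds fold := by simp [MapsEnds, fold]
  have h0 : MapsEnds (ContinuousMap.const unitInterval 0) := by simp [MapsEnds]
  have e0 : (ContinuousMap.const unitInterval (0 : unitInterval)) 0 = fold 0 := by simp [fold]
  have e1 : (ContinuousMap.const unitInterval (0 : unitInterval)) 1 = fold 1 := by simp [fold]
  have key := eqLift_homotopic (f := 𝟙 (susp B)) (g := rev B)
    (fun t => eqIncl (𝟙 (susp B)) (rev B) ≫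
      reparam B (linePath (ContinuousMap.const _ 0) fold t) (h0.linePath e0 e1 t))
    (fun c => continuous_reparam_path _ _ h0 e0 e1 _)
    (fun t => loop_hom_ext fun x s => by
      simp [linePath, fold, min_comm])
  refine Homotopic.symm ?_
  convert key using 1
  · refine eqIncl_cancel (loop_hom_ext fun x s => ?_)
    simp [linePath]
  · refine eqIncl_cancel (loop_hom_ext fun x s => ?_)
    have hx : ∀ s, ev (Hom.star (eqIncl (𝟙 (susp B)) (rev B)) x) s =
        ev (Hom.star (eqIncl (𝟙 (susp B)) (rev B)) x) (unitInterval.symm s) := fun s =>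
      congrArg (fun z => ev z s) (x.2 : (_ : susp B) = _)
    simp only [eqLift_eqIncl, Category.id_comp, star_comp_apply, ev_reparam, linePath,
      ContinuousMap.coe_mk, line_one, fold]
    rcases min_choice s (unitInterval.symm s) with h | h <;> rw [h]
    exact hx s

/-! ### Split exactness of homotopy invariant functors inverting the kernel class -/

/-- The loops in `A` whose image under `π` is symmetric. -/
abbrev symPreimage (π : A ⟶ B) : CStarAlgCat.{u} := eqAlg (suspMap π) (suspMap π ≫ rev B)

/-- The quotient is the algebra of symmetric loops in `B`, which is contractible. A section `s` of
`π` splits it, because `Σs` sends symmetric loops to loops with symmetric image. -/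
lemma kernelClass_symPreimage {ι : I ⟶ A} {π : A ⟶ B} (h : IsSplitExtension ι π)
    (e : suspMap ι ≫ suspMap π = suspMap ι ≫ suspMap π ≫ rev B) :
    kernelClass (eqLift (f := suspMap π) (g := suspMap π ≫ rev B) (suspMap ι) e) := by
  have c := eqIncl_condition (suspMap π) (suspMap π ≫ rev B)
  refine ⟨symLoops B, eqLift (eqIncl _ _ ≫ suspMap π) (by simpa using c), ⟨?_, ?_, ?_⟩,
    symLoops_contractible B⟩
  · exact fun x y hxy => h.susp.injective (congrArg Subtype.val hxy)
  · intro a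
    constructor
    · intro ha
      obtain ⟨x, hx⟩ := (h.susp.exact (Hom.star (eqIncl _ _) a)).1 (congrArg Subtype.val ha)
      exact ⟨x, Subtype.ext hx⟩
    · rintro ⟨x, rfl⟩
      exact Subtype.ext ((h.susp.exact (Hom.star (suspMap ι) x)).2 ⟨x, rfl⟩)
  · obtain ⟨s, hs⟩ := h.split
    have hs' : suspMap s ≫ suspMap π = 𝟙 _ := by rw [← suspMap_comp, hs, suspMap_id]
    refine ⟨eqLift (eqIncl _ _ ≫ suspMap s) ?_, eqIncl_cancel ?_⟩
    · have := eqIncl_condition (𝟙 (susp B)) (rev B)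
      simp only [Category.comp_id] at this
      rw [Category.assoc, hs', Category.assoc, reassoc_of% hs', Category.comp_id, ← this]
    · rw [Category.assoc, eqLift_eqIncl, ← Category.assoc, eqLift_eqIncl, Category.assoc, hs',
        Category.comp_id, Category.id_comp]

variable {𝒜 : Type v} [Category.{w} 𝒜] [Preadditive 𝒜]

/-- The formula `1 - sπ` for the projection onto the kernel is realised by a homomorphism, `concat`
with a reversed loop. That homomorphism misses `ΣI` only by a contractible quotient. -/
theorem isSplitExact_suspension_comp (F : CStarAlgCat.{u} ⥤ 𝒜) (hF : IsHomotopyInvariant F)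
    (hadd : ∀ ⦃A B : CStarAlgCat.{u}⦄ (f g : A ⟶ susp B), F.map (concat f g) = F.map f + F.map g)
    (hk : kernelClass.IsInvertedBy F) : IsSplitExact (suspension ⋙ F) := by
  intro I A B ι π h
  have hz : ∀ A B : CStarAlgCat.{u}, F.map (zeroHom A (susp B)) = 0 := fun A B => by
    have := hadd (zeroHom A (susp B)) (zeroHom A (susp B))
    rw [hF _ _ (concat_zeroHom_homotopic _)] at this
    exact left_eq_add.1 this
  have hrev : ∀ B : CStarAlgCat.{u}, F.map (rev B) = - 𝟙 _ := fun B => by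
    have := hadd (𝟙 (susp B)) (𝟙 _ ≫ rev B)
    rw [hF _ _ (concat_rev_homotopic _), hz, Category.id_comp, F.map_id] at this
    exact eq_neg_of_add_eq_zero_right this.symm
  have hιπ : suspMap ι ≫ suspMap π = zeroHom _ _ := by
    rw [← suspMap_comp, h.comp_eq_zero, suspMap_zeroHom]
  obtain ⟨s, hs⟩ := h.split
  have hs' : suspMap s ≫ suspMap π = 𝟙 _ := by rw [← suspMap_comp, hs, suspMap_id]
  have e : suspMap ι ≫ suspMap π = suspMap ι ≫ suspMap π ≫ rev B := by
    rw [← Category.assoc, hιπ, zeroHom_comp]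
  -- The additive inverse of `sπ`, so that `concat (𝟙 _) q` represents `1 - sπ`.
  let q : susp A ⟶ susp A := suspMap π ≫ suspMap s ≫ rev A
  have hκ : concat (𝟙 _) q ≫ suspMap π = concat (𝟙 _) q ≫ suspMap π ≫ rev B := by
    have h1 : concat (𝟙 _) q ≫ suspMap π = suspMap π ≫ reparam B tent mapsEnds_tent := by
      rw [concat_comp_suspMap, Category.id_comp, ← concat_rev, Category.assoc, Category.assoc,
        rev_comp_suspMap, reassoc_of% hs']
    rw [← Category.assoc, h1, Category.assoc]
    congr 1
    exact loop_hom_ext fun x t => by simp [tent_symm]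
  let κ : susp A ⟶ symPreimage π := eqLift (concat (𝟙 _) q) hκ
  let ι' : susp I ⟶ symPreimage π := eqLift (suspMap ι) e
  have hι' : IsIso (F.map ι') := hk _ (kernelClass_symPreimage h e)
  let r : F.obj (susp A) ⟶ F.obj (susp I) := F.map κ ≫ inv (F.map ι')
  refine ⟨?_, ⟨⟨r, F.map (suspMap s), ?_, ?_, ?_⟩⟩⟩
  · change F.map (suspMap ι) ≫ F.map (suspMap π) = 0
    rw [← F.map_comp, hιπ, hz]
  · change F.map (suspMap ι) ≫ F.map κ ≫ inv (F.map ι') = 𝟙 _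
    -- On `ΣI` the second loop vanishes because `ιπ = 0`; what remains is the first loop run at
    -- double speed, which is homotopic to itself.
    have h2 : suspMap ι ≫ κ = reparam I firstHalf mapsEnds_firstHalf ≫ ι' := by
      apply eqIncl_cancel
      rw [Category.assoc, Category.assoc, eqLift_eqIncl, eqLift_eqIncl, comp_concat,
        ← Category.assoc (suspMap ι) (suspMap π), hιπ, zeroHom_comp, concat_zeroHom,
        Category.comp_id, reparam_comp_suspMap]
    rw [← Category.assoc, ← F.map_comp, h2, F.map_comp, hF _ _ reparam_firstHalf_homotopic,
      F.map_id, Category.id_comp, IsIso.hom_inv_id]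
  · change F.map (suspMap s) ≫ F.map (suspMap π) = 𝟙 _
    rw [← F.map_comp, hs', F.map_id]
  · change (F.map κ ≫ inv (F.map ι')) ≫ F.map (suspMap ι) + F.map (suspMap π) ≫ F.map (suspMap s)
      = 𝟙 _
    have h3 : F.map (suspMap ι) = F.map ι' ≫ F.map (eqIncl _ _) := by
      rw [← F.map_comp, eqLift_eqIncl]
    rw [h3, Category.assoc, IsIso.inv_hom_id_assoc, ← F.map_comp, eqLift_eqIncl, hadd, F.map_id,
      F.map_comp, F.map_comp, hrev]
    simp

end CStarAlgCat

namespace Stab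

variable {H : Type v} [Category.{w} H] {S : H ⥤ H}

/-! ### Representatives of morphisms of the stabilisation -/

/-- The image of a representing morphism `j` stages later. -/
def mapIter {p q : ℕ} {X Y : H} (f : iter S p X ⟶ iter S q Y) :
    ∀ j : ℕ, iter S (p + j) X ⟶ iter S (q + j) Y
  | 0 => f
  | j + 1 => S.map (mapIter f j)

lemma homMk_succ {X Y : Stab S} (p q : ℕ) (h : (p : ℤ) - X.deg = (q : ℤ) - Y.deg)
    (h' : ((p + 1 : ℕ) : ℤ) - X.deg = ((q + 1 : ℕ) : ℤ) - Y.deg)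
    (f : iter S p X.obj ⟶ iter S q Y.obj) :
    (homMk (p + 1) (q + 1) h' (S.map f) : X ⟶ Y) = homMk p q h f :=
  Rep.mk_succ ⟨p, q, h, f⟩

lemma homMk_mapIter {X Y : Stab S} (p q j : ℕ) (h : (p : ℤ) - X.deg = (q : ℤ) - Y.deg)
    (h' : ((p + j : ℕ) : ℤ) - X.deg = ((q + j : ℕ) : ℤ) - Y.deg)
    (f : iter S p X.obj ⟶ iter S q Y.obj) :
    (homMk (p + j) (q + j) h' (mapIter f j) : X ⟶ Y) = homMk p q h f := by
  induction j with
  | zero => rfl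
  | succ j ih =>
    exact (homMk_succ (p + j) (q + j) (by push_cast at h' ⊢; linarith) h' (mapIter f j)).trans
      (ih _)

lemma Rep.lift_eq {X Y : Stab S} (p q j : ℕ) (h : (p : ℤ) - X.deg = (q : ℤ) - Y.deg)
    (f : iter S p X.obj ⟶ iter S q Y.obj) :
    (⟨p, q, h, f⟩ : Rep X Y).lift j =
      ⟨p + j, q + j, by push_cast; linarith, mapIter f j⟩ := by
  induction j with
  | zero => rfl
  | succ j ih => exact congrArg Rep.succ ih

/-- Lifts compose additively, so a chain of elementary identifications can be pushed to one later
stage where both representatives coincide. -/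
lemma Rep.exists_lift_eq {X Y : Stab S} {r r' : Rep X Y} (h : r.mk' = r'.mk') :
    ∃ i j, r.lift i = r'.lift j := by
  have := Quot.eqvGen_exact h
  clear h
  induction this with
  | rel x y h => exact ⟨1, 0, h.symm⟩
  | refl x => exact ⟨0, 0, rfl⟩
  | symm x y _ ih => obtain ⟨i, j, h⟩ := ih; exact ⟨j, i, h.symm⟩
  | trans x y z _ _ ih ih' =>
    obtain ⟨i, j, h⟩ := ih
    obtain ⟨i', j', h'⟩ := ih'
    refine ⟨i + i', j' + j, ?_⟩
    rw [← Rep.lift_add, h, Rep.lift_add, add_comm j, ← Rep.lift_add, h', Rep.lift_add]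

lemma exists_mapIter_eq {X Y : Stab S} {p q : ℕ} {h h' : (p : ℤ) - X.deg = (q : ℤ) - Y.deg}
    {f f' : iter S p X.obj ⟶ iter S q Y.obj}
    (e : (homMk p q h f : X ⟶ Y) = homMk p q h' f') : ∃ j, mapIter f j = mapIter f' j := by
  obtain ⟨i, j, hij⟩ := Rep.exists_lift_eq e
  have hp := congrArg Rep.p hij
  rw [Rep.lift_p, Rep.lift_p] at hp
  obtain rfl : i = j := by simpa using hp
  rw [Rep.lift_eq, Rep.lift_eq] at hij
  exact ⟨i, by simpa using hij⟩

lemma mapIter_eq_of_le {X Y : H} {p q : ℕ} {f f' : iter S p X ⟶ iter S q Y} {i j : ℕ} (hij : i ≤ j)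
    (h : mapIter f i = mapIter f' i) : mapIter f j = mapIter f' j := by
  induction j, hij using Nat.le_induction with
  | base => exact h
  | succ j _ ih => exact congrArg S.map ih

lemma exists_homMk_eq {X Y : Stab S} (x : X ⟶ Y) :
    ∃ n : ℕ, ∀ (p q : ℕ) (h : (p : ℤ) - X.deg = (q : ℤ) - Y.deg), n ≤ p →
      ∃ f, x = homMk p q h f := by
  induction x using hom_induction with
  | hP p q h f =>
    refine ⟨p, fun p' q' h' hp => ?_⟩
    obtain ⟨j, rfl⟩ := Nat.exists_eq_add_of_le hp
    obtain rfl : q' = q + j := by push_cast at h'; omega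
    exact ⟨mapIter f j, (homMk_mapIter p q j h h' f).symm⟩

lemma exists_stage (N : ℕ) (X Y Z : Stab S) : ∃ p q r : ℕ, N ≤ p ∧ N ≤ q ∧ N ≤ r ∧
    (p : ℤ) - X.deg = q - Y.deg ∧ (q : ℤ) - Y.deg = r - Z.deg := by
  -- The common shift exceeds each absolute degree by at least `N`, so all three stages are at least
  -- `N` and truncation to `ℕ` loses nothing.
  refine ⟨(X.deg + (N + X.deg.natAbs + Y.deg.natAbs + Z.deg.natAbs)).toNat,
    (Y.deg + (N + X.deg.natAbs + Y.deg.natAbs + Z.deg.natAbs)).toNat,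
    (Z.deg + (N + X.deg.natAbs + Y.deg.natAbs + Z.deg.natAbs)).toNat, ?_, ?_, ?_, ?_, ?_⟩ <;> omega

/-- Simultaneous representatives of three morphisms, with target an iterate of order at least `2`. -/
lemma exists_homMk_eq₃ {X Y : Stab S} (x y z : X ⟶ Y) :
    ∃ (p q : ℕ) (h : (p : ℤ) - X.deg = ((q + 2 : ℕ) : ℤ) - Y.deg) (f g k : _),
      x = homMk p (q + 2) h f ∧ y = homMk p (q + 2) h g ∧ z = homMk p (q + 2) h k := by
  obtain ⟨n, hn⟩ := exists_homMk_eq x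
  obtain ⟨n', hn'⟩ := exists_homMk_eq y
  obtain ⟨n'', hn''⟩ := exists_homMk_eq z
  obtain ⟨p, q, -, hp, hq, -, h, -⟩ := exists_stage (n + n' + n'' + 2) X Y Y
  obtain ⟨q, rfl⟩ := Nat.exists_eq_add_of_le' (show 2 ≤ q by omega)
  obtain ⟨f, hf⟩ := hn p (q + 2) h (by omega)
  obtain ⟨g, hg⟩ := hn' p (q + 2) h (by omega)
  obtain ⟨k, hk⟩ := hn'' p (q + 2) h (by omega)
  exact ⟨p, q, h, f, g, k, hf, hg, hk⟩

/-! ### The addition on the stabilisation -/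

variable (S) in
/-- A group structure up to homotopy on the suspensions in a category with a suspension functor,
commutative on double suspensions. -/
structure SuspAddition where
  add {A B : H} : (A ⟶ S.obj B) → (A ⟶ S.obj B) → (A ⟶ S.obj B)
  neg {A B : H} : (A ⟶ S.obj B) → (A ⟶ S.obj B)
  zero (A B : H) : A ⟶ B
  map_zero (A B : H) : S.map (zero A B) = zero _ _
  comp_add {A B C : H} (k : A ⟶ B) (f g : B ⟶ S.obj C) : k ≫ add f g = add (k ≫ f) (k ≫ g)
  add_comp {A B C : H} (f g : A ⟶ S.obj B) (k : B ⟶ C) :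
    add f g ≫ S.map k = add (f ≫ S.map k) (g ≫ S.map k)
  map_add {A B : H} (f g : A ⟶ S.obj B) : S.map (add f g) = add (S.map f) (S.map g)
  zero_add {A B : H} (f : A ⟶ S.obj B) : add (zero _ _) f = f
  neg_add {A B : H} (f : A ⟶ S.obj B) : add (neg f) f = zero _ _
  add_assoc {A B : H} (f g k : A ⟶ S.obj (S.obj B)) : add (add f g) k = add f (add g k)
  add_comm {A B : H} (f g : A ⟶ S.obj (S.obj B)) : add f g = add g f

namespace SuspAddition

variable (a : SuspAddition S)

/-- The addition of morphisms into an iterated suspension; a dummy value for the zeroth iterate. -/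
def addIter {A Y : H} : ∀ {q : ℕ}, (A ⟶ iter S q Y) → (A ⟶ iter S q Y) → (A ⟶ iter S q Y)
  | 0, f, _ => f
  | _ + 1, f, g => a.add f g

lemma map_addIter {A Y : H} : ∀ {q : ℕ} (_ : 0 < q) (f g : A ⟶ iter S q Y),
    S.map (a.addIter f g) = a.addIter (q := q + 1) (S.map f) (S.map g)
  | _ + 1, _, f, g => a.map_add f g

lemma mapIter_addIter {X Y : H} {p q : ℕ} (hq : 0 < q) (f g : iter S p X ⟶ iter S q Y) (j : ℕ) :
    mapIter (a.addIter f g) j = a.addIter (mapIter f j) (mapIter g j) := by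
  induction j with
  | zero => rfl
  | succ j ih => exact (congrArg S.map ih).trans (a.map_addIter (by omega) _ _)

/-- `z` is the sum of `x` and `y`, formed at some stage. -/
def IsSum {X Y : Stab S} (x y z : X ⟶ Y) : Prop :=
  ∃ (p q : ℕ) (h : (p : ℤ) - X.deg = (q : ℤ) - Y.deg) (f g : _), 0 < q ∧
    x = homMk p q h f ∧ y = homMk p q h g ∧ z = homMk p q h (a.addIter f g)

lemma exists_isSum {X Y : Stab S} (x y : X ⟶ Y) : ∃ z, a.IsSum x y z := by
  obtain ⟨p, q, h, f, g, -, hf, hg, -⟩ := exists_homMk_eq₃ x y y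
  exact ⟨_, p, q + 2, h, f, g, by omega, hf, hg, rfl⟩

/-- Makes the chosen sum independent of representatives: move both pairs to a stage where they
coincide; addition commutes with suspension once the target is itself a suspension. -/
lemma IsSum.unique {X Y : Stab S} {x y z z' : X ⟶ Y} (h : a.IsSum x y z) (h' : a.IsSum x y z') :
    z = z' := by
  obtain ⟨p, q, e, f, g, hq, hf, hg, hz⟩ := h
  obtain ⟨p', q', e', f', g', hq', hf', hg', hz'⟩ := h'
  wlog hp : p ≤ p' generalizing p q f g p' q' f' g' z z'
  · exact (this p' q' e' f' g' hq' hf' hg' hz' p q e f g hq hf hg hz (by omega)).symm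
  obtain ⟨j, rfl⟩ := Nat.exists_eq_add_of_le hp
  obtain rfl : q' = q + j := by push_cast at e'; omega
  rw [← homMk_mapIter p q j e e', hf'] at hf
  rw [← homMk_mapIter p q j e e', hg'] at hg
  obtain ⟨i, hi⟩ := exists_mapIter_eq hf
  obtain ⟨i', hi'⟩ := exists_mapIter_eq hg
  have hi := mapIter_eq_of_le (Nat.le_add_right i i') hi
  have hi' := mapIter_eq_of_le (Nat.le_add_left i' i) hi'
  have e'' : ((p + j + (i + i') : ℕ) : ℤ) - X.deg = ((q + j + (i + i') : ℕ) : ℤ) - Y.deg := by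
    push_cast at e' ⊢; linarith
  rw [hz, hz', ← homMk_mapIter p q j e e', a.mapIter_addIter hq,
    ← homMk_mapIter (p + j) (q + j) (i + i') e' e'', ← homMk_mapIter (p + j) (q + j) (i + i') e' e'',
    a.mapIter_addIter hq', a.mapIter_addIter hq', hi, hi']

/-- The addition of morphisms of the stabilisation. -/
def sum {X Y : Stab S} (x y : X ⟶ Y) : X ⟶ Y := (a.exists_isSum x y).choose

lemma sum_homMk {X Y : Stab S} (p q : ℕ) (h : (p : ℤ) - X.deg = ((q + 1 : ℕ) : ℤ) - Y.deg)
    (f g : iter S p X.obj ⟶ S.obj (iter S q Y.obj)) :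
    a.sum (homMk p (q + 1) h f : X ⟶ Y) (homMk p (q + 1) h g) = homMk p (q + 1) h (a.add f g) :=
  (a.exists_isSum _ _).choose_spec.unique a ⟨p, q + 1, h, f, g, by omega, rfl, rfl, rfl⟩

/-- The zero morphism of the stabilisation. -/
lemma exists_zero (X Y : Stab S) : ∃ z : X ⟶ Y, ∀ (p q : ℕ)
    (h : (p : ℤ) - X.deg = (q : ℤ) - Y.deg), z = homMk p q h (a.zero _ _) := by
  have key : ∀ (p q j : ℕ) (h : (p : ℤ) - X.deg = (q : ℤ) - Y.deg)
      (h' : ((p + j : ℕ) : ℤ) - X.deg = ((q + j : ℕ) : ℤ) - Y.deg),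
      (homMk p q h (a.zero _ _) : X ⟶ Y) = homMk (p + j) (q + j) h' (a.zero _ _) := by
    intro p q j h h'
    rw [← homMk_mapIter p q j h h']
    congr 1
    clear h h'
    induction j with
    | zero => rfl
    | succ j ih => exact (congrArg S.map ih).trans (a.map_zero _ _)
  obtain ⟨p, q, -, -, -, -, h, -⟩ := exists_stage 0 X Y Y
  refine ⟨homMk p q h (a.zero _ _), fun p' q' h' => ?_⟩
  rcases le_total p p' with hp | hp <;> obtain ⟨j, rfl⟩ := Nat.exists_eq_add_of_le hp
  · obtain rfl : q' = q + j := by push_cast at h'; omega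
    exact key _ _ _ _ _
  · obtain rfl : q = q' + j := by push_cast at h; omega
    exact (key _ _ _ _ _).symm

lemma exists_neg {X Y : Stab S} (x : X ⟶ Y) : ∃ y : X ⟶ Y,
    a.sum y x = (a.exists_zero X Y).choose := by
  obtain ⟨p, q, h, f, -, -, hf, -, -⟩ := exists_homMk_eq₃ x x x
  refine ⟨homMk p (q + 2) h (a.neg f), ?_⟩
  rw [hf, (a.exists_zero X Y).choose_spec p (q + 2) h]
  exact (a.sum_homMk p (q + 1) h _ _).trans (congrArg _ (a.neg_add f))

/-- The abelian group structure on the morphisms of the stabilisation. -/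
abbrev homGroup (X Y : Stab S) : AddCommGroup (X ⟶ Y) :=
  letI : Add (X ⟶ Y) := ⟨a.sum⟩
  letI : Zero (X ⟶ Y) := ⟨(a.exists_zero X Y).choose⟩
  letI : Neg (X ⟶ Y) := ⟨fun x => (a.exists_neg x).choose⟩
  { AddGroup.ofLeftAxioms (G := X ⟶ Y)
      (fun x y z => by
        obtain ⟨p, q, h, f, g, k, rfl, rfl, rfl⟩ := exists_homMk_eq₃ x y z
        change a.sum (a.sum _ _) _ = a.sum _ (a.sum _ _)
        erw [a.sum_homMk p (q + 1), a.sum_homMk p (q + 1), a.sum_homMk p (q + 1),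
          a.sum_homMk p (q + 1), a.add_assoc]
        rfl)
      (fun x => by
        obtain ⟨p, q, h, f, -, -, rfl, -, -⟩ := exists_homMk_eq₃ x x x
        change a.sum (a.exists_zero X Y).choose _ = _
        rw [(a.exists_zero X Y).choose_spec p (q + 2) h]
        exact (a.sum_homMk p (q + 1) h _ _).trans (congrArg _ (a.zero_add f)))
      (fun x => (a.exists_neg x).choose_spec) with
    add_comm := fun x y => by
      obtain ⟨p, q, h, f, g, -, rfl, rfl, -⟩ := exists_homMk_eq₃ x y y
      change a.sum _ _ = a.sum _ _
      erw [a.sum_homMk p (q + 1), a.sum_homMk p (q + 1), a.add_comm]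
      rfl }

/-- The stabilisation is preadditive. -/
abbrev preadditive : Preadditive (Stab S) where
  homGroup := a.homGroup
  add_comp X Y Z x y z := by
    change a.sum x y ≫ z = a.sum (x ≫ z) (y ≫ z)
    obtain ⟨n, hx⟩ := exists_homMk_eq x
    obtain ⟨n', hy⟩ := exists_homMk_eq y
    obtain ⟨n'', hz⟩ := exists_homMk_eq z
    obtain ⟨p, q, r, hp, hq, hr, h, h'⟩ := exists_stage (n + n' + n'' + 1) X Y Z
    obtain ⟨q, rfl⟩ := Nat.exists_eq_add_of_le' (show 1 ≤ q by omega)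
    obtain ⟨r, rfl⟩ := Nat.exists_eq_add_of_le' (show 1 ≤ r by omega)
    have h₁ : ((p + 1 : ℕ) : ℤ) - X.deg = ((q + 1 + 1 : ℕ) : ℤ) - Y.deg := by
      push_cast at h ⊢; linarith
    have h₁' : ((q + 1 + 1 : ℕ) : ℤ) - Y.deg = ((r + 1 + 1 : ℕ) : ℤ) - Z.deg := by
      push_cast at h' ⊢; linarith
    obtain ⟨f, rfl⟩ := hx (p + 1) (q + 1 + 1) h₁ (by omega)
    obtain ⟨g, rfl⟩ := hy (p + 1) (q + 1 + 1) h₁ (by omega)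
    -- The right factor is represented one stage earlier than the summands: at their stage it is
    -- then of the form `S.map k`, the only kind of map for which `a.add_comp` gives additivity on
    -- the right.
    obtain ⟨k, rfl⟩ := hz (q + 1) (r + 1) h' (by omega)
    rw [← homMk_mapIter (q + 1) (r + 1) 1 h' h₁', homMk_comp, homMk_comp]
    exact ((congrArg (· ≫ _) (a.sum_homMk (p + 1) (q + 1) h₁ f g)).trans
      (homMk_comp _ _ _ _ _ _ _)).trans
      ((congrArg (homMk (p + 1) (r + 1 + 1) (h₁.trans h₁')) (a.add_comp f g k)).trans
        (a.sum_homMk (p + 1) (r + 1) (h₁.trans h₁') _ _).symm)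
  comp_add X Y Z x y z := by
    change x ≫ a.sum y z = a.sum (x ≫ y) (x ≫ z)
    obtain ⟨n, hx⟩ := exists_homMk_eq x
    obtain ⟨n', hy⟩ := exists_homMk_eq y
    obtain ⟨n'', hz⟩ := exists_homMk_eq z
    obtain ⟨p, q, r, hp, hq, hr, h, h'⟩ := exists_stage (n + n' + n'' + 1) X Y Z
    obtain ⟨r, rfl⟩ := Nat.exists_eq_add_of_le' (show 1 ≤ r by omega)
    obtain ⟨f, rfl⟩ := hx p q h (by omega)
    obtain ⟨g, rfl⟩ := hy q (r + 1) h' (by omega)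
    obtain ⟨k, rfl⟩ := hz q (r + 1) h' (by omega)
    rw [homMk_comp, homMk_comp]
    exact ((congrArg (_ ≫ ·) (a.sum_homMk q r h' g k)).trans (homMk_comp _ _ _ _ _ _ _)).trans
      ((congrArg (homMk p (r + 1) (h.trans h')) (a.comp_add f g k)).trans
        (a.sum_homMk p r (h.trans h') _ _).symm)

end SuspAddition

end Stab

/-! ### Addition on a localisation compatible with biproducts -/

namespace LocalizationAddition

open Limits MorphismProperty

lemma loc_induction {C : Type v} [Category.{w} C] {W : MorphismProperty C}
    {P : ∀ ⦃X Y : W.Localization⦄, (X ⟶ Y) → Prop}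
    (comp : ∀ ⦃X Y Z⦄ (f : X ⟶ Y) (g : Y ⟶ Z), P f → P g → P (f ≫ g))
    (map : ∀ ⦃X Y : C⦄ (f : X ⟶ Y), P (W.Q.map f))
    (inv : ∀ ⦃X Y : C⦄ (w : X ⟶ Y) (hw : W w), P (Localization.Construction.wInv w hw))
    ⦃X Y : W.Localization⦄ (f : X ⟶ Y) : P f := by
  let P' : MorphismProperty W.Localization := fun X Y f => P f
  have : P'.IsStableUnderComposition := ⟨fun {X Y Z} f g hf hg => comp f g hf hg⟩
  have h := Localization.Construction.morphismProperty_eq_top P' map inv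
  have hf : P' f := by rw [h]; exact MorphismProperty.top_apply f
  exact hf

variable {C : Type v} [Category.{w} C] [Preadditive C] [HasBinaryBiproducts C]

/-- Any product cone is isomorphic to the biproduct, so closure under `biprod.map` is enough. -/
lemma isStableUnderProductsOfShape_walkingPair (W : MorphismProperty C) [W.RespectsIso]
    (hW : ∀ ⦃X Y X' Y' : C⦄ (f : X ⟶ Y) (g : X' ⟶ Y'), W f → W g → W (biprod.map f g)) :
    W.IsStableUnderProductsOfShape WalkingPair where
  condition X₁ X₂ c₁ c₂ hc₁ hc₂ f hf φ hφ := by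
    have key : ∀ (X : Discrete WalkingPair ⥤ C) (c : Cone X), IsLimit c →
        IsIso (biprod.lift (c.π.app ⟨WalkingPair.left⟩) (c.π.app ⟨WalkingPair.right⟩)) := by
      intro X c hc
      let c' : Cone X := ⟨X.obj ⟨WalkingPair.left⟩ ⊞ X.obj ⟨WalkingPair.right⟩,
        Discrete.natTrans fun j => match j with
          | ⟨WalkingPair.left⟩ => biprod.fst
          | ⟨WalkingPair.right⟩ => biprod.snd⟩
      have hl : hc.lift c' ≫ c.π.app ⟨WalkingPair.left⟩ = biprod.fst := hc.fac c' _
      have hr : hc.lift c' ≫ c.π.app ⟨WalkingPair.right⟩ = biprod.snd := hc.fac c' _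
      refine ⟨hc.lift c', hc.hom_ext ?_, ?_⟩
      · rintro ⟨_ | _⟩
        · simp [hl]
        · simp [hr]
      · apply biprod.hom_ext
        · simp [hl]
        · simp [hr]
    have h₁ := key X₁ c₁ hc₁
    have h₂ := key X₂ c₂ hc₂
    have hm := hW _ _ (hf ⟨WalkingPair.left⟩) (hf ⟨WalkingPair.right⟩)
    refine (W.arrow_mk_iso_iff (Arrow.isoMk (asIso (biprod.lift (c₁.π.app ⟨WalkingPair.left⟩)
      (c₁.π.app ⟨WalkingPair.right⟩))) (asIso (biprod.lift (c₂.π.app ⟨WalkingPair.left⟩)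
      (c₂.π.app ⟨WalkingPair.right⟩))) ?_)).2 hm
    apply biprod.hom_ext <;> simp [hφ]

variable (W : MorphismProperty C)

/-- The object of the original category underlying an object of the localisation. -/
abbrev under (X : W.Localization) : C := (Localization.Construction.objEquiv W).symm X

-- Checked on generators. For a formal inverse, write `0 = w ≫ 0` and cancel `w`. This is what lets
-- the image of zero serve as zero in the localisation.
omit [HasBinaryBiproducts C] in
lemma comp_zeroQ {X Y : W.Localization} (k : X ⟶ Y) :
    ∀ Z : C, k ≫ W.Q.map (0 : under W Y ⟶ Z) = W.Q.map (0 : under W X ⟶ Z) := by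
  refine loc_induction (P := fun X Y k => ∀ Z : C,
    k ≫ W.Q.map (0 : under W Y ⟶ Z) = W.Q.map (0 : under W X ⟶ Z)) ?_ ?_ ?_ k
  · intro X Y Z k k' h h' T
    exact (Category.assoc _ _ _).trans ((congrArg _ (h' T)).trans (h T))
  · intro X Y k Z
    exact (W.Q.map_comp k (0 : Y ⟶ Z)).symm.trans (congrArg _ comp_zero)
  · intro X Y w hw Z
    have : W.Q.map (0 : X ⟶ Z) = (Localization.Construction.wIso w hw).hom ≫
        W.Q.map (0 : Y ⟶ Z) := (congrArg _ comp_zero.symm).trans (W.Q.map_comp w (0 : Y ⟶ Z))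
    exact (congrArg _ this).trans (Iso.inv_hom_id_assoc _ _)

variable [W.ContainsIdentities] [W.IsStableUnderProductsOfShape WalkingPair]

/-- The image of a biproduct in the localisation is a product. -/
def isLimitQ (Y Z : C) : IsLimit (BinaryFan.mk (W.Q.map (biprod.fst : Y ⊞ Z ⟶ Y))
    (W.Q.map (biprod.snd : Y ⊞ Z ⟶ Z))) :=
  haveI := Localization.preservesProductsOfShape W.Q W WalkingPair
  mapIsLimitOfPreservesOfIsLimit W.Q _ _ (BinaryBiproduct.isLimit Y Z)

variable {W}

/-- The morphism into the image of a biproduct with given components. -/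
def plift {X : W.Localization} {Y Z : C} (f : X ⟶ W.Q.obj Y) (g : X ⟶ W.Q.obj Z) :
    X ⟶ W.Q.obj (Y ⊞ Z) :=
  (isLimitQ W Y Z).lift (BinaryFan.mk f g)

@[simp]
lemma plift_fst {X : W.Localization} {Y Z : C} (f : X ⟶ W.Q.obj Y) (g : X ⟶ W.Q.obj Z) :
    plift f g ≫ W.Q.map biprod.fst = f :=
  (isLimitQ W Y Z).fac (BinaryFan.mk f g) ⟨WalkingPair.left⟩

@[simp]
lemma plift_fst_assoc {X T : W.Localization} {Y Z : C} (f : X ⟶ W.Q.obj Y) (g : X ⟶ W.Q.obj Z)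
    (h : _ ⟶ T) : plift f g ≫ W.Q.map biprod.fst ≫ h = f ≫ h := by
  rw [← Category.assoc, plift_fst]

@[simp]
lemma plift_snd {X : W.Localization} {Y Z : C} (f : X ⟶ W.Q.obj Y) (g : X ⟶ W.Q.obj Z) :
    plift f g ≫ W.Q.map biprod.snd = g :=
  (isLimitQ W Y Z).fac (BinaryFan.mk f g) ⟨WalkingPair.right⟩

@[simp]
lemma plift_snd_assoc {X T : W.Localization} {Y Z : C} (f : X ⟶ W.Q.obj Y) (g : X ⟶ W.Q.obj Z)
    (h : _ ⟶ T) : plift f g ≫ W.Q.map biprod.snd ≫ h = g ≫ h := by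
  rw [← Category.assoc, plift_snd]

lemma plift_ext {X : W.Localization} {Y Z : C} {f g : X ⟶ W.Q.obj (Y ⊞ Z)}
    (h : f ≫ W.Q.map biprod.fst = g ≫ W.Q.map biprod.fst)
    (h' : f ≫ W.Q.map biprod.snd = g ≫ W.Q.map biprod.snd) : f = g :=
  BinaryFan.IsLimit.hom_ext (isLimitQ W Y Z) h h'

/-- The sum of two morphisms into the image of an object. -/
def sumQ {X : W.Localization} {Y : C} (f g : X ⟶ W.Q.obj Y) : X ⟶ W.Q.obj Y :=
  plift f g ≫ W.Q.map (biprod.fst + biprod.snd)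

/-- Together with `exists_common₃` this moves the group axioms back to the original category:
several morphisms factor through one common `l` followed by genuine morphisms, and only those get
added. -/
lemma sumQ_comp_map {X : W.Localization} {P Y : C} (l : X ⟶ W.Q.obj P) (a b : P ⟶ Y) :
    sumQ (l ≫ W.Q.map a) (l ≫ W.Q.map b) = l ≫ W.Q.map (a + b) := by
  have : plift (l ≫ W.Q.map a) (l ≫ W.Q.map b) = l ≫ W.Q.map (biprod.lift a b) :=
    plift_ext (by rw [plift_fst, Category.assoc, ← Functor.map_comp, biprod.lift_fst])
      (by rw [plift_snd, Category.assoc, ← Functor.map_comp, biprod.lift_snd])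
  rw [sumQ, this, Category.assoc, ← Functor.map_comp, Preadditive.comp_add, biprod.lift_fst,
    biprod.lift_snd]

lemma comp_sumQ {X X' : W.Localization} {Y : C} (k : X' ⟶ X) (f g : X ⟶ W.Q.obj Y) :
    k ≫ sumQ f g = sumQ (k ≫ f) (k ≫ g) := by
  have : plift (k ≫ f) (k ≫ g) = k ≫ plift f g :=
    plift_ext (by simp) (by simp)
  rw [sumQ, sumQ, this, Category.assoc]

lemma exists_common₃ {X : W.Localization} {Y : C} (f g k : X ⟶ W.Q.obj Y) :
    ∃ (P : C) (l : X ⟶ W.Q.obj P) (a b c : P ⟶ Y),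
      f = l ≫ W.Q.map a ∧ g = l ≫ W.Q.map b ∧ k = l ≫ W.Q.map c :=
  ⟨_, plift (plift f g) k, biprod.fst ≫ biprod.fst, biprod.fst ≫ biprod.snd, biprod.snd,
    by simp, by simp, by simp⟩

/-- The sum of two morphisms of the localisation. -/
def sum {X Y : W.Localization} (f g : X ⟶ Y) : X ⟶ Y :=
  sumQ (X := X) (Y := under W Y) f g

lemma sumQ_comp_Q {X : W.Localization} {Y Z : C} (f g : X ⟶ W.Q.obj Y) (k : Y ⟶ Z) :
    sumQ f g ≫ W.Q.map k = sumQ (f ≫ W.Q.map k) (g ≫ W.Q.map k) := by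
  obtain ⟨P, l, a, b, -, rfl, rfl, -⟩ := exists_common₃ f g g
  simp only [sumQ_comp_map, Category.assoc, ← Functor.map_comp, Preadditive.add_comp]

lemma comp_sum {X Y Z : W.Localization} (k : X ⟶ Y) (f g : Y ⟶ Z) :
    k ≫ sum f g = sum (k ≫ f) (k ≫ g) :=
  comp_sumQ (Y := under W Z) k f g

/-- Additivity in this variable is not formal, since the sum uses the addition of the target. It is
checked on generators, and a formal inverse inherits it from the morphism it inverts. -/
lemma sum_comp {Y Z : W.Localization} (k : Y ⟶ Z) :
    ∀ {X : W.Localization} (f g : X ⟶ Y), sum f g ≫ k = sum (f ≫ k) (g ≫ k) := by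
  refine loc_induction (P := fun Y Z k => ∀ {X : W.Localization} (f g : X ⟶ Y),
    sum f g ≫ k = sum (f ≫ k) (g ≫ k)) ?_ ?_ ?_ k
  · intro X Y Z k k' h h' T f g
    rw [← Category.assoc, h, h', Category.assoc, Category.assoc]
  · intro Y Z k T f g
    exact sumQ_comp_Q f g k
  · intro Y Z w hw T f g
    have h : (sum f g : T ⟶ W.Q.obj Z) =
        sum (f ≫ Localization.Construction.wInv w hw) (g ≫ Localization.Construction.wInv w hw) ≫
          (Localization.Construction.wIso w hw).hom := by
      refine Eq.trans ?_ (sumQ_comp_Q (f ≫ Localization.Construction.wInv w hw)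
        (g ≫ Localization.Construction.wInv w hw) w).symm
      change _ = sumQ ((f ≫ (Localization.Construction.wIso w hw).inv) ≫
        (Localization.Construction.wIso w hw).hom) ((g ≫ (Localization.Construction.wIso w hw).inv) ≫
        (Localization.Construction.wIso w hw).hom)
      rw [Category.assoc, Category.assoc, Iso.inv_hom_id, Category.comp_id, Category.comp_id]
      rfl
    rw [h, Category.assoc, Iso.hom_inv_id, Category.comp_id]

/-- The abelian group structure on the morphisms of the localisation. -/
abbrev homGroup (X Y : W.Localization) : AddCommGroup (X ⟶ Y) :=
  letI : Add (X ⟶ Y) := ⟨sum⟩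
  letI : Zero (X ⟶ Y) := ⟨W.Q.map (0 : under W X ⟶ under W Y)⟩
  letI : Neg (X ⟶ Y) := ⟨fun f => f ≫ W.Q.map (- 𝟙 (under W Y))⟩
  { AddGroup.ofLeftAxioms (G := X ⟶ Y)
      (fun x y z => by
        obtain ⟨P, l, a, b, c, h, h', h''⟩ := exists_common₃ (Y := under W Y) x y z
        change sumQ (Y := under W Y) (sumQ (Y := under W Y) x y) z =
          sumQ (Y := under W Y) x (sumQ (Y := under W Y) y z)
        rw [h, h', h'']
        simp only [sumQ_comp_map, add_assoc])
      (fun x => by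
        change sumQ (Y := under W Y) (W.Q.map (0 : under W X ⟶ under W Y)) x = x
        rw [← comp_zeroQ W (Y := Y) x]
        have := sumQ_comp_map (Y := under W Y) (P := under W Y) x 0 (𝟙 _)
        rw [W.Q.map_id, zero_add, W.Q.map_id] at this
        exact (congrArg _ (Category.comp_id _).symm).trans (this.trans (Category.comp_id _)))
      (fun x => by
        change sumQ (Y := under W Y) (x ≫ W.Q.map (- 𝟙 (under W Y))) x =
          W.Q.map (0 : under W X ⟶ under W Y)
        rw [← comp_zeroQ W (Y := Y) x]
        have := sumQ_comp_map (Y := under W Y) (P := under W Y) x (- 𝟙 _) (𝟙 _)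
        rw [W.Q.map_id, neg_add_cancel] at this
        exact (congrArg _ (Category.comp_id _).symm).trans this) with
    add_comm := fun x y => by
      obtain ⟨P, l, a, b, -, h, h', -⟩ := exists_common₃ (Y := under W Y) x y y
      change sumQ (Y := under W Y) x y = sumQ (Y := under W Y) y x
      rw [h, h', sumQ_comp_map, sumQ_comp_map, add_comm] }

variable (W) in
/-- The localisation of a preadditive category with biproducts at a class of morphisms that is
stable under products is preadditive. -/
abbrev preadditive : Preadditive W.Localization where
  homGroup := homGroup
  add_comp _ _ _ f g k := sum_comp k f g
  comp_add _ _ _ k f g := comp_sum k f g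

variable (W) in
lemma additive_Q : letI := preadditive W; W.Q.Additive :=
  letI := preadditive W
  { map_add := fun {X Y f g} => by
      have := sumQ_comp_map (W := W) (𝟙 (W.Q.obj X)) f g
      simp only [Category.id_comp] at this
      exact this.symm }

end LocalizationAddition

/-! ### Suspension and degree shift in the stabilisation -/

namespace Stab

variable {H : Type v} [Category.{w} H] (S : H ⥤ H)

/-- The canonical natural isomorphism `(S X)_m ≅ X_(m+1)`. -/
def suspIso (m n : ℤ) (h : m + 1 = n) : S ⋙ incl S m ≅ incl S n :=
  NatIso.ofComponents (fun X =>
    { hom := homMk 0 1 (by simp [incl]; linarith) (𝟙 (S.obj X))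
      inv := homMk 1 0 (by simp [incl]; linarith) (𝟙 (S.obj X))
      hom_inv_id := (homMk_comp _ _ _ _ _ _ _).trans
        ((congrArg (homMk 0 0 rfl) (Category.id_comp (𝟙 (S.obj X)))).trans (homMk_id _ 0))
      inv_hom_id := (homMk_comp _ _ _ _ _ _ _).trans
        ((congrArg (homMk 1 1 rfl) (Category.id_comp (𝟙 (S.obj X)))).trans (homMk_id _ 1)) })
    (fun {X Y} f => by
      have e : (incl S n).map f =
          (homMk 1 1 rfl (S.map f) : (incl S n).obj X ⟶ (incl S n).obj Y) :=
        (homMk_succ (X := (incl S n).obj X) (Y := (incl S n).obj Y) 0 0 rfl rfl f).symm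
      refine (homMk_comp _ _ _ _ _ _ _).trans (Eq.symm ?_)
      rw [e]
      exact (homMk_comp _ _ _ _ _ _ _).trans (congrArg (homMk 0 1 _)
        ((Category.id_comp (S.map f)).trans (Category.comp_id (S.map f)).symm)))

/-- A stable object `X_m` is isomorphic to `(S^j X)_(m-j)`. -/
def iterIso (X : Stab S) (n : ℤ) (j : ℕ) (h : n + j = X.deg) :
    X ≅ (incl S n).obj (iter S j X.obj) where
  hom := homMk j 0 (by simp [incl]; linarith) (𝟙 (iter S j X.obj))
  inv := homMk 0 j (by simp [incl]; linarith) (𝟙 (iter S j X.obj))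
  hom_inv_id := (homMk_comp _ _ _ _ _ _ _).trans
    ((congrArg (homMk j j rfl) (Category.id_comp (𝟙 (iter S j X.obj)))).trans (homMk_id _ j))
  inv_hom_id := (homMk_comp _ _ _ _ _ _ _).trans
    ((congrArg (homMk 0 0 rfl) (Category.id_comp (𝟙 (iter S j X.obj)))).trans (homMk_id _ 0))

end Stab

namespace CStarAlgCat
open Limits

/-! ### The stable homotopy category is preadditive -/

variable {A B C D E I : CStarAlgCat.{u}}

/-- The group structure on homotopy classes of homomorphisms into a suspension. -/
def suspAddition : Stab.SuspAddition hoSusp.{u} where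
  add {A B} := Quot.map₂ (fun f g : A.as ⟶ susp B.as => concat f g)
    (fun a b b' h => by
      rw [HomRel.compClosure_iff_self] at h
      exact HomRel.CompClosure.of ((Homotopic.refl a).concat h))
    (fun a a' b h => by
      rw [HomRel.compClosure_iff_self] at h
      exact HomRel.CompClosure.of (h.concat (Homotopic.refl b)))
  neg {A B} f := f ≫ (Quotient.functor Homotopic).map (rev B.as)
  zero A B := (Quotient.functor Homotopic).map (zeroHom A.as B.as)
  map_zero _ _ := rfl
  comp_add := by rintro A B C ⟨k⟩ ⟨f⟩ ⟨g⟩; rfl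
  add_comp := by
    rintro A B C ⟨f⟩ ⟨g⟩ ⟨k⟩
    exact congrArg (Quotient.functor Homotopic).map (concat_comp_suspMap f g k)
  map_add := by
    rintro A B ⟨f⟩ ⟨g⟩
    refine (congrArg (Quotient.functor Homotopic).map (suspMap_concat f g)).trans ?_
    exact CategoryTheory.Quotient.sound _ (concat_homotopic_concat' _ _).symm
  zero_add := by
    rintro A B ⟨f⟩
    exact CategoryTheory.Quotient.sound Homotopic (zeroHom_concat_homotopic f)
  neg_add := by
    rintro A B ⟨f⟩
    exact CategoryTheory.Quotient.sound Homotopic (rev_concat_homotopic f)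
  add_assoc := by
    rintro A B ⟨f⟩ ⟨g⟩ ⟨k⟩
    exact CategoryTheory.Quotient.sound Homotopic (concat_assoc_homotopic f g k)
  add_comm := by
    rintro A B ⟨f⟩ ⟨g⟩
    exact CategoryTheory.Quotient.sound Homotopic (concat_comm_homotopic f g)

instance : Preadditive SH.{u} := suspAddition.preadditive

theorem isConcatAddition : IsConcatAddition.{u} inferInstance :=
  fun _ _ p q h _ _ => suspAddition.sum_homMk p q h _ _

lemma toSH_map_eq_of_homotopic (m : ℤ) {f g : A ⟶ B} (h : Homotopic f g) :
    (toSH m).map f = (toSH m).map g :=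
  congrArg (Stab.incl hoSusp m).map (CategoryTheory.Quotient.sound _ h)

/-- The canonical natural isomorphism `(ΣA)_m ≅ A_(m+1)`. -/
def toSHSuspIso (m n : ℤ) (h : m + 1 = n) : suspension ⋙ toSH m ≅ toSH.{u} n :=
  (CategoryTheory.Functor.isoWhiskerLeft (Quotient.functor Homotopic) (Stab.suspIso hoSusp m n h) :)

/-- The canonical isomorphism `(ΣA)_m ≅ A_(m+1)`. -/
def delta (m n : ℤ) (h : m + 1 = n) (A : CStarAlgCat.{u}) :
    (toSH m).obj (susp A) ≅ (toSH n).obj A := (toSHSuspIso m n h).app A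

lemma delta_naturality (m n : ℤ) (h : m + 1 = n) (f : A ⟶ B) :
    (toSH m).map (suspMap f) ≫ (delta m n h B).hom = (delta m n h A).hom ≫ (toSH n).map f :=
  (toSHSuspIso m n h).hom.naturality f

/-- Passing from `(ΣB)_m` to `B_(m+1)` turns a homomorphism into a representative whose target stage
is a suspension, where addition is concatenation by definition. -/
lemma toSH_map_concat (m : ℤ) (f g : A ⟶ susp B) :
    (toSH m).map (concat f g) = (toSH m).map f + (toSH m).map g := by
  have key : ∀ f : A ⟶ susp B, (toSH m).map f ≫ (delta m (m + 1) rfl B).hom =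
      Stab.homMk (X := (toSH m).obj A) (Y := (toSH (m + 1)).obj B) 0 1
        (by simp [toSH, Stab.incl]) ((Quotient.functor Homotopic).map f) := fun f =>
    (Stab.homMk_comp _ _ _ _ _ _ _).trans (congrArg (Stab.homMk 0 1 _) (Category.comp_id _))
  rw [← cancel_mono (delta m (m + 1) rfl B).hom, Preadditive.add_comp, key, key, key]
  exact (isConcatAddition ((toSH m).obj A) ((toSH (m + 1)).obj B) 0 0
    (by simp [toSH, Stab.incl]) f g).symm

/-- Into a suspension, zero is idempotent for concatenation; the general case is one desuspension
away. -/
lemma toSH_map_zeroHom (m : ℤ) : (toSH m).map (zeroHom A B) = 0 := by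
  have h1 : ∀ (m : ℤ) (A B : CStarAlgCat.{u}), (toSH m).map (zeroHom A (susp B)) = 0 := fun m A B => by
    have := toSH_map_concat m (zeroHom A (susp B)) (zeroHom A (susp B))
    rw [toSH_map_eq_of_homotopic m (concat_zeroHom_homotopic _)] at this
    exact left_eq_add.1 this
  rw [← cancel_epi (delta (m - 1) m (by ring) A).hom, ← delta_naturality, suspMap_zeroHom, h1,
    Limits.comp_zero, Limits.zero_comp]

/-! ### Direct sums -/

/-- The direct sum of two C⋆-algebras. -/
def prod (A B : CStarAlgCat.{u}) : CStarAlgCat.{u} where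
  carrier := A × B

/-- The first projection of a direct sum. -/
def fst (A B : CStarAlgCat.{u}) : prod A B ⟶ A := ofStar (NonUnitalStarAlgHom.fst ℂ A B)

/-- The second projection of a direct sum. -/
def snd (A B : CStarAlgCat.{u}) : prod A B ⟶ B := ofStar (NonUnitalStarAlgHom.snd ℂ A B)

/-- The first inclusion of a direct sum. -/
def inl (A B : CStarAlgCat.{u}) : A ⟶ prod A B := ofStar (NonUnitalStarAlgHom.inl ℂ A B)

/-- The second inclusion of a direct sum. -/
def inr (A B : CStarAlgCat.{u}) : B ⟶ prod A B := ofStar (NonUnitalStarAlgHom.inr ℂ A B)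

/-- The direct sum of two homomorphisms. -/
def prodMap (f : A ⟶ C) (g : B ⟶ D) : prod A B ⟶ prod C D :=
  ofStar (NonUnitalStarAlgHom.prod ((Hom.star f).comp (Hom.star (fst A B)))
    ((Hom.star g).comp (Hom.star (snd A B))))

lemma inl_fst : inl A B ≫ fst A B = 𝟙 A := rfl
lemma inr_snd : inr A B ≫ snd A B = 𝟙 B := rfl
lemma inl_snd : inl A B ≫ snd A B = zeroHom A B := rfl
lemma inr_fst : inr A B ≫ fst A B = zeroHom B A := rfl
lemma prodMap_fst (f : A ⟶ C) (g : B ⟶ D) : prodMap f g ≫ fst C D = fst A B ≫ f := rfl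
lemma prodMap_snd (f : A ⟶ C) (g : B ⟶ D) : prodMap f g ≫ snd C D = snd A B ≫ g := rfl

/-- Reparametrisation of loops in a direct sum, independently in the two components. -/
def prodReparam (A B : CStarAlgCat.{u}) (φ ψ : C(unitInterval, unitInterval)) (hφ : MapsEnds φ)
    (hψ : MapsEnds ψ) : susp (prod A B) ⟶ susp (prod A B) := ofStar
  { toFun := fun x => (⟨⟨fun t => ((ev x (φ t)).1, (ev x (ψ t)).2),
      (continuous_fst.comp ((continuous_ev x).comp φ.continuous)).prodMk
        (continuous_snd.comp ((continuous_ev x).comp ψ.continuous))⟩,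
      Prod.ext (congrArg Prod.fst (hφ.ev_zero x) :) (congrArg Prod.snd (hψ.ev_zero x) :),
      Prod.ext (congrArg Prod.fst (hφ.ev_one x) :) (congrArg Prod.snd (hψ.ev_one x) :)⟩ :
      loops (prod A B))
    map_smul' := fun _ _ => rfl
    map_zero' := rfl
    map_add' := fun _ _ => rfl
    map_mul' := fun _ _ => rfl
    map_star' := fun _ => rfl }

/-- The two summands of a direct sum can be reparametrised independently, each back to the identity.
-/
lemma concat_fst_inl_snd_inr_homotopic (A B : CStarAlgCat.{u}) :
    Homotopic (concat (suspMap (fst A B ≫ inl A B)) (suspMap (snd A B ≫ inr A B)))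
      (𝟙 (susp (prod A B))) := by
  refine ⟨fun t => prodReparam A B (linePath firstHalf (ContinuousMap.id _) t)
    (linePath secondHalf (ContinuousMap.id _) t)
    (mapsEnds_firstHalf.linePath (by simp) (by simp) t)
    (mapsEnds_secondHalf.linePath (by simp) (by simp) t), fun x => ?_, ?_, ?_⟩
  · exact continuous_path_susp _ x ((continuous_fst.comp ((continuous_ev x).comp
      (continuous_linePath firstHalf (ContinuousMap.id _)))).prodMk
      (continuous_snd.comp ((continuous_ev x).comp
      (continuous_linePath secondHalf (ContinuousMap.id _)))))
  · refine loop_hom_ext fun x t => ?_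
    change (((ev x (line 0 (firstHalf t) t)).1, (ev x (line 0 (secondHalf t) t)).2) : A × B) =
      ((ev x (firstHalf t)).1, (0 : B)) + ((0 : A), (ev x (secondHalf t)).2)
    simp
  · refine loop_hom_ext fun x t => ?_
    change (((ev x (line 1 (firstHalf t) t)).1, (ev x (line 1 (secondHalf t) t)).2) : A × B) =
      ev x t
    simp only [line_one]
    rfl

lemma toSH_total (m : ℤ) (A B : CStarAlgCat.{u}) :
    (toSH m).map (fst A B) ≫ (toSH m).map (inl A B) +
      (toSH m).map (snd A B) ≫ (toSH m).map (inr A B) = 𝟙 _ := by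
  rw [← (toSH m).map_comp, ← (toSH m).map_comp, ← cancel_epi (delta (m - 1) m (by ring) _).hom,
    Preadditive.comp_add, ← delta_naturality, ← delta_naturality, Category.comp_id,
    ← Preadditive.add_comp, ← toSH_map_concat,
    toSH_map_eq_of_homotopic (m - 1) (concat_fst_inl_snd_inr_homotopic A B), (toSH (m - 1)).map_id,
    Category.id_comp]

@[simp] lemma toSH_inl_fst (m : ℤ) (A B : CStarAlgCat.{u}) :
    (toSH m).map (inl A B) ≫ (toSH m).map (fst A B) = 𝟙 _ := by
  rw [← (toSH m).map_comp, inl_fst, (toSH m).map_id]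

@[simp] lemma toSH_inl_snd (m : ℤ) (A B : CStarAlgCat.{u}) :
    (toSH m).map (inl A B) ≫ (toSH m).map (snd A B) = 0 := by
  rw [← (toSH m).map_comp, inl_snd, toSH_map_zeroHom]

@[simp] lemma toSH_inr_fst (m : ℤ) (A B : CStarAlgCat.{u}) :
    (toSH m).map (inr A B) ≫ (toSH m).map (fst A B) = 0 := by
  rw [← (toSH m).map_comp, inr_fst, toSH_map_zeroHom]

@[simp] lemma toSH_inr_snd (m : ℤ) (A B : CStarAlgCat.{u}) :
    (toSH m).map (inr A B) ≫ (toSH m).map (snd A B) = 𝟙 _ := by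
  rw [← (toSH m).map_comp, inr_snd, (toSH m).map_id]

/-- The direct sum as a biproduct in the stable homotopy category. -/
def prodBicone (m : ℤ) (A B : CStarAlgCat.{u}) :
    BinaryBicone ((toSH m).obj A) ((toSH m).obj B) where
  pt := (toSH m).obj (prod A B)
  fst := (toSH m).map (fst A B)
  snd := (toSH m).map (snd A B)
  inl := (toSH m).map (inl A B)
  inr := (toSH m).map (inr A B)

lemma exists_iso_toSH (X : SH.{u}) (n : ℤ) (h : n ≤ X.deg) :
    ∃ A : CStarAlgCat.{u}, Nonempty (X ≅ (toSH n).obj A) :=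
  ⟨_, ⟨Stab.iterIso hoSusp X n (X.deg - n).toNat (by omega)⟩⟩

lemma hasBinaryBiproduct_of_iso {𝒞 : Type v} [Category.{w} 𝒞] [Preadditive 𝒞] {X Y X' Y' : 𝒞}
    (e : X ≅ X') (e' : Y ≅ Y') (b : BinaryBicone X' Y')
    (hb : b.fst ≫ b.inl + b.snd ≫ b.inr = 𝟙 b.pt) : HasBinaryBiproduct X Y :=
  ⟨⟨_, isBinaryBilimitOfTotal
    { pt := b.pt
      fst := b.fst ≫ e.inv
      snd := b.snd ≫ e'.inv
      inl := e.hom ≫ b.inl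
      inr := e'.hom ≫ b.inr } (by simpa using hb)⟩⟩

instance : HasBinaryBiproducts SH.{u} where
  has_binary_biproduct X Y := by
    -- Direct sums only combine objects of equal degree; suspending allows any lower degree, so the
    -- minimum works for both.
    obtain ⟨A, ⟨e⟩⟩ := exists_iso_toSH X (min X.deg Y.deg) (min_le_left _ _)
    obtain ⟨B, ⟨e'⟩⟩ := exists_iso_toSH Y (min X.deg Y.deg) (min_le_right _ _)
    exact hasBinaryBiproduct_of_iso e e' (prodBicone _ A B) (toSH_total _ A B)

/-- The direct sum is isomorphic to the biproduct in the stable homotopy category. -/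
@[simps] def prodIso (m : ℤ) (A B : CStarAlgCat.{u}) :
    (toSH m).obj (prod A B) ≅ (toSH m).obj A ⊞ (toSH m).obj B where
  hom := biprod.lift ((toSH m).map (fst A B)) ((toSH m).map (snd A B))
  inv := biprod.desc ((toSH m).map (inl A B)) ((toSH m).map (inr A B))
  hom_inv_id := by rw [biprod.lift_desc, toSH_total]
  inv_hom_id := by apply biprod.hom_ext <;> apply biprod.hom_ext' <;> simp

/-! ### Stability of the class `X` under biproducts -/

lemma kernelClass.prodMap_id {ι : I ⟶ A} (h : kernelClass ι) (C : CStarAlgCat.{u}) :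
    kernelClass (prodMap ι (𝟙 C)) := by
  obtain ⟨B, π, h, hB⟩ := h
  obtain ⟨s, hs⟩ := h.split
  refine ⟨B, fst A C ≫ π, ⟨fun x y hxy => ?_, fun a => ?_, s ≫ inl A C, ?_⟩, hB⟩
  · exact Prod.ext (h.injective (congrArg Prod.fst hxy)) (congrArg Prod.snd hxy :)
  · refine (h.exact (a : A × C).1).trans ⟨?_, ?_⟩
    · rintro ⟨x, hx⟩
      exact ⟨((x, (a : A × C).2) : I × C), Prod.ext hx rfl⟩
    · rintro ⟨x, hx⟩
      exact ⟨(x : I × C).1, congrArg Prod.fst hx⟩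
  · rw [Category.assoc, ← Category.assoc (inl A C), inl_fst, Category.id_comp, hs]

instance : stableKernelClass.{u}.IsStableUnderComposition :=
  ⟨fun f g hf hg => .comp f g hf hg⟩

instance : stableKernelClass.{u}.RespectsIso :=
  MorphismProperty.RespectsIso.mk _ (fun _ _ hf => .comp _ _ (.iso _ inferInstance) hf)
    (fun _ _ hf => .comp _ _ hf (.iso _ inferInstance))

instance : stableKernelClass.{u}.ContainsIdentities := ⟨fun _ => .iso _ inferInstance⟩

lemma stableKernelClass.of_iso {X Y X' Y' : SH.{u}} {f : X ⟶ Y} {f' : X' ⟶ Y'} (e : X ≅ X')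
    (e' : Y ≅ Y') (w : f ≫ e'.hom = e.hom ≫ f') (h : stableKernelClass f') :
    stableKernelClass f := by
  have : f = e.hom ≫ f' ≫ e'.inv := by rw [← Category.assoc, ← w, Category.assoc, e'.hom_inv_id,
    Category.comp_id]
  rw [this]
  exact .comp _ _ (.iso _ inferInstance) (.comp _ _ h (.iso _ inferInstance))

/-- Kernel inclusions remain such after suspension, so one can be moved to any lower degree, to meet
another object there. -/
lemma exists_kernelClass_iso {ι : I ⟶ A} (h : kernelClass ι) (m n : ℤ) (j : ℕ)
    (hj : n + j = m) :
    ∃ (I' A' : CStarAlgCat.{u}) (ι' : I' ⟶ A') (e : (toSH m).obj I ≅ (toSH n).obj I')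
      (e' : (toSH m).obj A ≅ (toSH n).obj A'), kernelClass ι' ∧
        (toSH m).map ι ≫ e'.hom = e.hom ≫ (toSH n).map ι' := by
  induction j generalizing n with
  | zero =>
    obtain rfl : n = m := by simpa using hj
    exact ⟨I, A, ι, Iso.refl _, Iso.refl _, h, by simp⟩
  | succ j ih =>
    obtain ⟨I', A', ι', e, e', h', w⟩ := ih (n + 1) (by push_cast at hj; linarith)
    refine ⟨_, _, suspMap ι', e ≪≫ (delta n (n + 1) rfl I').symm,
      e' ≪≫ (delta n (n + 1) rfl A').symm, h'.susp, ?_⟩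
    rw [← cancel_mono (delta n (n + 1) rfl A').hom]
    simp only [Iso.trans_hom, Iso.symm_hom, Category.assoc, Iso.inv_hom_id, Category.comp_id, w,
      delta_naturality, Iso.inv_hom_id_assoc]

lemma stableKernelClass.biprod_map_toSH {ι : I ⟶ A} (h : kernelClass ι) (m : ℤ)
    (C : CStarAlgCat.{u}) :
    stableKernelClass (biprod.map ((toSH m).map ι) (𝟙 ((toSH m).obj C))) := by
  refine stableKernelClass.of_iso (prodIso m I C).symm (prodIso m A C).symm ?_
    (stableKernelClass.kernel m (prodMap ι (𝟙 C)) (h.prodMap_id C))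
  rw [← cancel_mono (prodIso m A C).hom, Category.assoc, Category.assoc, Iso.symm_hom,
    Iso.symm_hom, Iso.inv_hom_id, Category.comp_id, Iso.eq_inv_comp]
  apply biprod.hom_ext
  · simp only [prodIso_hom, Category.assoc, biprod.map_fst, biprod.lift_fst,
      biprod.lift_fst_assoc, ← (toSH m).map_comp, prodMap_fst]
  · simp only [prodIso_hom, Category.assoc, biprod.map_snd, biprod.lift_snd,
      ← (toSH m).map_comp, prodMap_snd, Category.comp_id]

lemma stableKernelClass.biprod_map_id {X Y : SH.{u}} {f : X ⟶ Y} (hf : stableKernelClass f)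
    (Z : SH.{u}) : stableKernelClass (biprod.map f (𝟙 Z)) := by
  induction hf with
  | @kernel m I A ι hι =>
    obtain ⟨I', A', ι', e₁, e₂, h', w⟩ := exists_kernelClass_iso hι m (min m Z.deg)
      (m - min m Z.deg).toNat (by omega)
    obtain ⟨C, ⟨e'⟩⟩ := exists_iso_toSH Z (min m Z.deg) (by omega)
    refine stableKernelClass.of_iso (biprod.mapIso e₁ e') (biprod.mapIso e₂ e') ?_
      (stableKernelClass.biprod_map_toSH h' _ C)
    apply biprod.hom_ext <;> simp [w]
  | iso f hf =>
    refine .iso _ ⟨biprod.map (inv f) (𝟙 Z), ?_, ?_⟩ <;> apply biprod.hom_ext <;> simp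
  | comp f g _ _ hf hg =>
    have : biprod.map (f ≫ g) (𝟙 Z) = biprod.map f (𝟙 Z) ≫ biprod.map g (𝟙 Z) := by
      apply biprod.hom_ext <;> simp
    rw [this]
    exact .comp _ _ hf hg

/-- Changing one summand at a time suffices, with the braiding exchanging the summands. -/
lemma stableKernelClass.biprod_map ⦃X Y X' Y' : SH.{u}⦄ (f : X ⟶ Y) (g : X' ⟶ Y')
    (hf : stableKernelClass f) (hg : stableKernelClass g) :
    stableKernelClass (biprod.map f g) := by
  have h : biprod.map f g = biprod.map f (𝟙 X') ≫ (biprod.braiding Y X').hom ≫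
      biprod.map g (𝟙 Y) ≫ (biprod.braiding Y' Y).hom := by
    apply biprod.hom_ext <;> simp
  rw [h]
  exact .comp _ _ (hf.biprod_map_id X') (.comp _ _ (.iso _ inferInstance)
    (.comp _ _ (hg.biprod_map_id Y) (.iso _ inferInstance)))

instance : stableKernelClass.{u}.IsStableUnderProductsOfShape WalkingPair :=
  LocalizationAddition.isStableUnderProductsOfShape_walkingPair _ stableKernelClass.biprod_map

instance : Preadditive SHLoc.{u} := LocalizationAddition.preadditive stableKernelClass

instance : locFunctor.{u}.Additive := LocalizationAddition.additive_Q stableKernelClass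

/-! ### Split exactness of the functor to the localisation -/

lemma IsSplitExact.of_iso {𝒜 : Type v} [Category.{w} 𝒜] [Preadditive 𝒜]
    {F G : CStarAlgCat.{u} ⥤ 𝒜} (hF : IsSplitExact F) (e : F ≅ G) : IsSplitExact G := by
  intro I A B ι π h
  obtain ⟨w, ⟨σ⟩⟩ := hF ι π h
  have w' : G.map ι ≫ G.map π = 0 := by
    rw [← cancel_epi (e.hom.app I), ← e.hom.naturality_assoc, ← e.hom.naturality, reassoc_of% w,
      comp_zero, zero_comp]
  exact ⟨w', ⟨σ.ofIso (ShortComplex.isoMk (e.app I) (e.app A) (e.app B)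
    (e.hom.naturality ι).symm (e.hom.naturality π).symm)⟩⟩

theorem isSplitExact_toSHLoc : IsSplitExact toSHLoc.{u} := by
  -- Degree `-1` is used because the criterion gives split exactness only after a suspension, and
  -- `(ΣA)_(-1) ≅ A_0`.
  have h := isSplitExact_suspension_comp (toSH.{u} (-1) ⋙ locFunctor)
    (fun A B f g h => congrArg locFunctor.map (toSH_map_eq_of_homotopic _ h))
    (fun A B f g => by
      simp only [Functor.comp_map, toSH_map_concat, Functor.map_add])
    (fun I A ι h => MorphismProperty.Q_inverts _ _ (stableKernelClass.kernel _ ι h))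
  exact h.of_iso (CategoryTheory.Functor.isoWhiskerRight (toSHSuspIso (-1) 0 (by norm_num)) locFunctor :)

theorem isSplitExact_coyoneda (D : CStarAlgCat.{u}) : IsSplitExact
    (toSHLoc ⋙ preadditiveCoyoneda.obj (Opposite.op (toSHLoc.obj D))) := by
  intro I A B ι π h
  obtain ⟨w, ⟨σ⟩⟩ := isSplitExact_toSHLoc ι π h
  have σ' := σ.map (preadditiveCoyoneda.obj (Opposite.op (toSHLoc.obj D)))
  exact ⟨_, ⟨σ'⟩⟩

theorem isSplitExactOp_yoneda (D : CStarAlgCat.{u}) : IsSplitExactOp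
    (toSHLoc.op ⋙ preadditiveYoneda.obj (toSHLoc.obj D)) := by
  intro I A B ι π h
  obtain ⟨w, ⟨σ⟩⟩ := isSplitExact_toSHLoc ι π h
  have σ' := σ.op.map (preadditiveYoneda.obj (toSHLoc.obj D))
  exact ⟨_, ⟨σ'⟩⟩

end CStarAlgCat

namespace Stab

variable {H : Type v} [Category.{w} H] {S : H ⥤ H}

/-! ### Generation of the morphisms of the stabilisation -/

/-- Any stable morphism is an unstable one conjugated by desuspensions; with `iterIso_succ` this
reduces naturality checks to two kinds of generators. -/
lemma homMk_eq_iterIso {X Y : Stab S} (p q : ℕ) (k : ℤ) (hp : k + p = X.deg) (hq : k + q = Y.deg)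
    (h : (p : ℤ) - X.deg = (q : ℤ) - Y.deg) (f : iter S p X.obj ⟶ iter S q Y.obj) :
    (homMk p q h f : X ⟶ Y) =
      (iterIso S X k p hp).hom ≫ (incl S k).map f ≫ (iterIso S Y k q hq).inv := by
  have e : ((incl S k).map f ≫ (iterIso S Y k q hq).inv) = homMk 0 q _ (f ≫ 𝟙 _) :=
    homMk_comp _ _ _ _ _ _ _
  rw [e]
  refine Eq.trans ?_ (homMk_comp _ _ _ _ _ _ _).symm
  exact congrArg (homMk p q h) ((Category.id_comp _).trans (Category.comp_id f)).symm

lemma iterIso_succ (X : Stab S) (n : ℤ) (j : ℕ) (h : n + (j + 1 : ℕ) = X.deg) :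
    (iterIso S X n (j + 1) h).hom = (iterIso S X (n + 1) j (by push_cast at h; linarith)).hom ≫
      (suspIso S n (n + 1) rfl).inv.app (iter S j X.obj) := by
  have h' := h
  push_cast at h'
  have e : (iterIso S X (n + 1) j (by linarith)).hom =
      (homMk (j + 1) 1 (by simp [incl]; linarith) (S.map (𝟙 (iter S j X.obj))) :
        X ⟶ (incl S (n + 1)).obj (iter S j X.obj)) := (homMk_succ _ _ _ _ _).symm
  rw [e]
  refine Eq.trans ?_ (homMk_comp _ _ _ _ _ _ _).symm
  exact congrArg (homMk _ _ _) ((Category.comp_id _).trans (S.map_id (iter S j X.obj))).symm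

/-- The morphisms of the stabilisation are generated by the morphisms of the original category and
the isomorphisms `(S X)_m ≅ X_(m+1)` and their inverses. -/
lemma hom_generation {P : ∀ ⦃X Y : Stab S⦄, (X ⟶ Y) → Prop}
    (comp : ∀ ⦃X Y Z⦄ (f : X ⟶ Y) (g : Y ⟶ Z), P f → P g → P (f ≫ g))
    (inv : ∀ ⦃X Y⦄ (e : X ≅ Y), P e.hom → P e.inv)
    (incl : ∀ (m : ℤ) ⦃X Y : H⦄ (f : X ⟶ Y), P ((incl S m).map f))
    (susp : ∀ (m : ℤ) (X : H), P ((suspIso S m (m + 1) rfl).hom.app X))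
    ⦃X Y : Stab S⦄ (x : X ⟶ Y) : P x := by
  have key : ∀ (X : Stab S) (j : ℕ) (n : ℤ) (h : n + j = X.deg), P (iterIso S X n j h).hom := by
    intro X j
    induction j with
    | zero =>
      rintro n h
      obtain ⟨X, m⟩ := X
      obtain rfl : n = m := by simpa using h
      exact incl n (𝟙 X)
    | succ j ih =>
      intro n h
      rw [iterIso_succ]
      exact comp _ _ (ih _ _) (inv ((suspIso S n (n + 1) rfl).app _) (susp _ _))
  induction x using hom_induction with
  | hP p q h f =>
    rw [homMk_eq_iterIso p q (X.deg - p) (by ring) (by linarith)]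
    exact comp _ _ (key _ _ _ _) (comp _ _ (incl _ _) (inv _ (key _ _ _ _)))

lemma doubleShiftIso_inv (X : H) : (doubleShiftIso S X).inv =
    (suspIso S 0 1 rfl).hom.app (S.obj X) ≫ (suspIso S 1 2 rfl).hom.app X := by
  have e : (suspIso S 1 2 rfl).hom.app X =
      (homMk 1 2 rfl (S.map (𝟙 (S.obj X))) : (incl S 1).obj (S.obj X) ⟶ (incl S 2).obj X) :=
    (homMk_succ (X := (incl S 1).obj (S.obj X)) (Y := (incl S 2).obj X) 0 1 rfl rfl
      (𝟙 (S.obj X))).symm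
  rw [e]
  refine Eq.trans ?_ (homMk_comp _ _ _ _ _ _ _).symm
  exact congrArg (homMk _ _ _) ((Category.id_comp _).trans (S.map_id (S.obj X))).symm

/-! ### Functors out of the stabilisation -/

variable {𝒜 : Type*} [Category* 𝒜]

lemma conj_eq {A A' A'' B B' B'' : 𝒜} (a : A ≅ A') (b : B ≅ B') (a' : A' ≅ A'') (b' : B' ≅ B'')
    (g : A ⟶ B) (f : A' ⟶ B') (h : g ≫ b.hom = a.hom ≫ f) :
    (a ≪≫ a').inv ≫ g ≫ (b ≪≫ b').hom = a'.inv ≫ f ≫ b'.hom := by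
  simp [reassoc_of% h]

section descend

variable (F : ℤ → H ⥤ 𝒜) (σ : ∀ m, S ⋙ F m ≅ F (m + 1))

/-- The isomorphism `F_k (S^p X) ≅ F_(k+p) X` obtained by iterating the structure isomorphisms. -/
def desusp (X : H) : ∀ (p : ℕ) (k m : ℤ) (_ : k + p = m), (F k).obj (iter S p X) ≅ (F m).obj X
  | 0, k, m, h => eqToIso (by rw [← h, Nat.cast_zero, add_zero]; rfl)
  | p + 1, k, m, h =>
    (σ k).app (iter S p X) ≪≫ desusp X p (k + 1) m (by push_cast at h; linarith)

/-- The value of the induced functor on a representative. -/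
def descendMap {X Y : Stab S} (p q : ℕ) (k : ℤ) (hp : k + p = X.deg) (hq : k + q = Y.deg)
    (f : iter S p X.obj ⟶ iter S q Y.obj) : (F X.deg).obj X.obj ⟶ (F Y.deg).obj Y.obj :=
  (desusp F σ X.obj p k X.deg hp).inv ≫ (F k).map f ≫ (desusp F σ Y.obj q k Y.deg hq).hom

lemma descendMap_succ {X Y : Stab S} (p q : ℕ) (k k' : ℤ) (hk : k + 1 = k')
    (hp : k + (p + 1 : ℕ) = X.deg) (hq : k + (q + 1 : ℕ) = Y.deg)
    (hp' : k' + p = X.deg) (hq' : k' + q = Y.deg) (f : iter S p X.obj ⟶ iter S q Y.obj) :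
    descendMap F σ (p + 1) (q + 1) k hp hq (S.map f) = descendMap F σ p q k' hp' hq' f := by
  subst hk
  exact conj_eq ((σ k).app _) ((σ k).app _) _ _ _ _ ((σ k).hom.naturality f)

/-- The functor on the stabilisation induced by functors `F_m` and isomorphisms
`F_m (S X) ≅ F_(m+1) X`. -/
def descendHom {X Y : Stab S} (x : X ⟶ Y) : (F X.deg).obj X.obj ⟶ (F Y.deg).obj Y.obj :=
  Quot.lift (fun r : Rep X Y => descendMap F σ r.p r.q (X.deg - r.p) (by ring)
    (by have := r.h; linarith) r.f)
    (by
      rintro r _ rfl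
      exact (descendMap_succ F σ r.p r.q _ _ (by simp only [Rep.succ]; push_cast; ring)
        _ _ _ _ r.f).symm) x

lemma descendHom_homMk {X Y : Stab S} (p q : ℕ) (k : ℤ) (hp : k + p = X.deg)
    (hq : k + q = Y.deg) (h : (p : ℤ) - X.deg = (q : ℤ) - Y.deg)
    (f : iter S p X.obj ⟶ iter S q Y.obj) :
    descendHom F σ (homMk p q h f : X ⟶ Y) = descendMap F σ p q k hp hq f := by
  obtain rfl : k = X.deg - p := by linarith
  rfl

/-- The functor on the stabilisation induced by functors `F_m` and isomorphisms
`F_m (S X) ≅ F_(m+1) X`. -/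
def descend : Stab S ⥤ 𝒜 where
  obj X := (F X.deg).obj X.obj
  map x := descendHom F σ x
  map_id X := by
    rw [← homMk_id X 0, descendHom_homMk F σ 0 0 X.deg (by simp) (by simp), descendMap]
    erw [(F X.deg).map_id]
    rw [Category.id_comp, Iso.inv_hom_id]
  map_comp {X Y Z} x y := by
    obtain ⟨n, hx⟩ := exists_homMk_eq x
    obtain ⟨n', hy⟩ := exists_homMk_eq y
    obtain ⟨p, q, r, hp, hq, -, h, h'⟩ := exists_stage (n + n') X Y Z
    obtain ⟨f, rfl⟩ := hx p q h (by omega)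
    obtain ⟨g, rfl⟩ := hy q r h' (by omega)
    rw [homMk_comp, descendHom_homMk F σ p r (X.deg - p) (by ring) (by linarith),
      descendHom_homMk F σ p q (X.deg - p) (by ring) (by linarith),
      descendHom_homMk F σ q r (X.deg - p) (by linarith) (by linarith)]
    simp [descendMap]

lemma descend_map_incl (m : ℤ) {X Y : H} (f : X ⟶ Y) :
    (descend F σ).map ((incl S m).map f) = (F m).map f := by
  refine (descendHom_homMk (X := (incl S m).obj X) (Y := (incl S m).obj Y) F σ 0 0 m (by simp [incl])
    (by simp [incl]) _ f).trans ?_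
  simp only [descendMap, desusp]
  exact (Category.id_comp _).trans (Category.comp_id _)

lemma descend_map_suspIso (m : ℤ) (X : H) :
    (descend F σ).map ((suspIso S m (m + 1) rfl).hom.app X) = (σ m).hom.app X := by
  refine (descendHom_homMk (X := (incl S m).obj (S.obj X)) (Y := (incl S (m + 1)).obj X)
    F σ 0 1 m (by simp [incl]) (by simp [incl]) _ (𝟙 (S.obj X))).trans ?_
  simp only [descendMap, desusp]
  refine (Category.id_comp _).trans ?_
  erw [(F m).map_id]
  refine (Category.id_comp _).trans ?_
  exact Category.comp_id _

end descend

/-! ### Natural transformations out of the stabilisation -/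

/-- A natural isomorphism of functors on the stabilisation, from isomorphisms on all `X_m` that are
natural in `X` and compatible with `(S X)_m ≅ X_(m+1)`. -/
def natIsoMk {L L' : Stab S ⥤ 𝒜} (ψ : ∀ X : Stab S, L.obj X ≅ L'.obj X)
    (hn : ∀ (m : ℤ) ⦃X Y : H⦄ (f : X ⟶ Y), L.map ((incl S m).map f) ≫ (ψ ((incl S m).obj Y)).hom =
      (ψ ((incl S m).obj X)).hom ≫ L'.map ((incl S m).map f))
    (hs : ∀ (m : ℤ) (X : H), L.map ((suspIso S m (m + 1) rfl).hom.app X) ≫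
      (ψ ((incl S (m + 1)).obj X)).hom = (ψ ((incl S m).obj (S.obj X))).hom ≫
        L'.map ((suspIso S m (m + 1) rfl).hom.app X)) : L ≅ L' :=
  NatIso.ofComponents ψ (fun {X Y} x => by
    refine hom_generation (P := fun X Y x => L.map x ≫ (ψ Y).hom = (ψ X).hom ≫ L'.map x)
      ?_ ?_ hn hs x
    · intro X Y Z f g hf hg
      rw [L.map_comp, Category.assoc, hg, reassoc_of% hf, L'.map_comp]
    · intro X Y e he
      rw [← cancel_epi (L.map e.hom), ← Category.assoc, ← L.map_comp, e.hom_inv_id, L.map_id,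
        Category.id_comp, reassoc_of% he, ← L'.map_comp, e.hom_inv_id, L'.map_id, Category.comp_id])

end Stab

namespace Stab

variable {H : Type v} [Category.{w} H] {S : H ⥤ H} {𝒜 : Type*} [Category* 𝒜]

/-! ### The functor on the stabilisation induced by a Bott periodic functor -/

section bott

variable (F : H ⥤ 𝒜) (β : F ≅ S ⋙ S ⋙ F)

variable (S) in
/-- The functor `X ↦ F (S^n X)`. -/
def iterComp : ℕ → H ⥤ 𝒜
  | 0 => F
  | n + 1 => S ⋙ iterComp n

/-- The periodicity isomorphism of `X ↦ F (S^n X)`. -/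
def iterBott : ∀ n : ℕ, iterComp S F n ≅ iterComp S F (n + 2)
  | 0 => β
  | n + 1 => (Functor.isoWhiskerLeft S (iterBott n) :)

variable (S) in
/-- The value at `X_m` of the functor induced by a Bott periodic functor. -/
def degComp : ℤ → H ⥤ 𝒜
  | Int.ofNat n => iterComp S F n
  -- In degree `-k` the value is `F (S^k X)`: `k` and `-k` have the same parity, so no desuspension
  -- is required.
  | Int.negSucc n => iterComp S F (n + 1)

/-- The structure isomorphisms of the family `degComp`. -/
def degIso : ∀ m : ℤ, S ⋙ degComp S F m ≅ degComp S F (m + 1)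
  | Int.ofNat n => Iso.refl (iterComp S F (n + 1))
  -- Going from degree `-k` to `-k + 1`, the exponent drops from `k + 1` to `k - 1`; inverse
  -- periodicity bridges the gap of two.
  | Int.negSucc 0 => (iterBott F β 0).symm
  | Int.negSucc (n + 1) => (iterBott F β (n + 1)).symm

/-- The periodicity isomorphisms of the family `degComp`. -/
def degBott : ∀ m : ℤ, degComp S F m ≅ degComp S F (m + 1 + 1)
  | Int.ofNat n => iterBott F β n
  -- Degrees `-1` and `1` already carry the same functor.
  | Int.negSucc 0 => Iso.refl (iterComp S F 1)
  | Int.negSucc 1 => (iterBott F β 0).symm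
  | Int.negSucc (n + 2) => (iterBott F β (n + 1)).symm

/-- Away from zero both composites use the same instances of `β`. Only the crossing at `-1` needs
cancellation: there `β` meets its inverse. -/
lemma degIso_degBott : ∀ (m : ℤ) (X : H),
    (degIso F β m).hom.app X ≫ (degBott F β (m + 1)).hom.app X =
      (degBott F β m).hom.app (S.obj X) ≫ (degIso F β (m + 1 + 1)).hom.app X
  | Int.ofNat n, X => by
    refine (Category.id_comp _).trans (Eq.symm ?_)
    exact Category.comp_id _
  | Int.negSucc 0, X => by
    refine Eq.trans ?_ (Category.id_comp _).symm
    exact (iterBott F β 0).inv_hom_id_app X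
  | Int.negSucc 1, X => by
    exact (Category.comp_id _).trans (Category.comp_id _).symm
  | Int.negSucc 2, X => rfl
  | Int.negSucc (n + 3), X => rfl

/-- The functor on the stabilisation induced by a Bott periodic functor. -/
def bottDescend : Stab S ⥤ 𝒜 := descend (degComp S F) (degIso F β)

/-- The periodicity isomorphism of the induced functor. -/
def bottDescendIso : bottDescend F β ≅ shift S ⋙ shift S ⋙ bottDescend F β :=
  natIsoMk (fun X => (degBott F β X.deg).app X.obj)
    (fun m X Y f => by
      have h1 : (bottDescend F β).map ((incl S m).map f) = _ := descend_map_incl _ (degIso F β) m f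
      have h2 : (shift S ⋙ shift S ⋙ bottDescend F β).map ((incl S m).map f) = _ :=
        descend_map_incl _ (degIso F β) (m + 1 + 1) f
      rw [h1, h2]
      exact (degBott F β m).hom.naturality f)
    (fun m X => by
      have h1 : (bottDescend F β).map ((suspIso S m (m + 1) rfl).hom.app X) = _ :=
        descend_map_suspIso _ (degIso F β) m X
      have h2 : (shift S ⋙ shift S ⋙ bottDescend F β).map ((suspIso S m (m + 1) rfl).hom.app X) =
        _ := descend_map_suspIso _ (degIso F β) (m + 1 + 1) X
      rw [h1, h2]
      exact degIso_degBott F β m X)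

/-- In degrees `0` and `1` the structure isomorphisms are identities, so the double shift maps to
the identity and only `β` remains. -/
lemma bottDescendIso_doubleShiftIso (X : H) :
    (bottDescendIso F β).hom.app ((incl S 0).obj X) ≫
      (bottDescend F β).map (doubleShiftIso S X).hom = β.hom.app X := by
  have h1 : (bottDescend F β).map (doubleShiftIso S X).inv = 𝟙 _ := by
    refine (congrArg _ (doubleShiftIso_inv X)).trans (((bottDescend F β).map_comp _ _).trans ?_)
    have h2 : (bottDescend F β).map ((suspIso S 0 1 rfl).hom.app (S.obj X)) = _ :=
      descend_map_suspIso _ (degIso F β) 0 (S.obj X)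
    have h3 : (bottDescend F β).map ((suspIso S 1 2 rfl).hom.app X) = _ :=
      descend_map_suspIso _ (degIso F β) 1 X
    exact (congrArg₂ (· ≫ ·) h2 h3).trans (Category.comp_id _)
  have h4 := ((bottDescend F β).mapIso (doubleShiftIso S X)).inv_hom_id
  have h5 : (bottDescend F β).map (doubleShiftIso S X).hom = 𝟙 _ := by
    refine Eq.trans ?_ h4
    refine Eq.trans (Category.id_comp _).symm (congrArg (· ≫ _) h1.symm)
  rw [h5]
  exact Category.comp_id _

end bott

/-! ### Uniqueness of Bott periodic functors on the stabilisation -/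

lemma int_two_step {P : ℤ → Prop} (h0 : ∀ m, 0 ≤ m → P m) (h : ∀ m < 0, P (m + 1 + 1) → P m)
    (m : ℤ) : P m := by
  have key : ∀ n : ℕ, ∀ m : ℤ, -(n : ℤ) ≤ m → P m := by
    intro n
    induction n with
    | zero => exact fun m hm => h0 m (by simpa using hm)
    | succ n ih =>
      intro m hm
      by_cases h1 : 0 ≤ m
      · exact h0 m h1
      · exact h m (by omega) (ih _ (by push_cast at hm; omega))
  exact key m.natAbs m (by omega)

lemma int_nonneg_induction {P : ∀ m : ℤ, 0 ≤ m → Prop} (h0 : P 0 le_rfl)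
    (h : ∀ (m : ℤ) (hm : 0 ≤ m), P m hm → P (m + 1) (by omega)) (m : ℤ) (hm : 0 ≤ m) : P m hm := by
  lift m to ℕ using hm
  induction m with
  | zero => exact h0
  | succ n ih => exact h n (by positivity) (ih _)

section unique

variable {L L' : Stab S ⥤ 𝒜} (b : L ≅ shift S ⋙ shift S ⋙ L) (b' : L' ≅ shift S ⋙ shift S ⋙ L')
  (φ : ∀ X : H, L.obj ((incl S 0).obj X) ≅ L'.obj ((incl S 0).obj X))

/-- Extension of an isomorphism in degree `0` to nonnegative degrees. -/
def extendNat : ∀ (n : ℕ) (X : H), L.obj ((incl S n).obj X) ≅ L'.obj ((incl S n).obj X)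
  | 0, X => φ X
  | n + 1, X => L.mapIso ((suspIso S n (n + 1 : ℕ) rfl).symm.app X) ≪≫ extendNat n (S.obj X) ≪≫
      L'.mapIso ((suspIso S n (n + 1 : ℕ) rfl).app X)

/-- Extension of an isomorphism in degree `0` to negative degrees. -/
def extendNeg : ∀ (n : ℕ) (X : H),
    L.obj ((incl S (Int.negSucc n)).obj X) ≅ L'.obj ((incl S (Int.negSucc n)).obj X)
  | 0, X => b.app ((incl S (Int.negSucc 0)).obj X) ≪≫ extendNat φ 1 X ≪≫
      (b'.app ((incl S (Int.negSucc 0)).obj X)).symm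
  | 1, X => b.app ((incl S (Int.negSucc 1)).obj X) ≪≫ extendNat φ 0 X ≪≫
      (b'.app ((incl S (Int.negSucc 1)).obj X)).symm
  | n + 2, X => b.app ((incl S (Int.negSucc (n + 2))).obj X) ≪≫ extendNeg n X ≪≫
      (b'.app ((incl S (Int.negSucc (n + 2))).obj X)).symm

/-- Extension of an isomorphism in degree `0` to all degrees. -/
def extend : ∀ (m : ℤ) (X : H), L.obj ((incl S m).obj X) ≅ L'.obj ((incl S m).obj X)
  | Int.ofNat n => extendNat φ n
  | Int.negSucc n => extendNeg b b' φ n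

lemma extend_succ : ∀ (m : ℤ) (_ : 0 ≤ m) (X : H),
    L.map ((suspIso S m (m + 1) rfl).hom.app X) ≫ (extend b b' φ (m + 1) X).hom =
      (extend b b' φ m (S.obj X)).hom ≫ L'.map ((suspIso S m (m + 1) rfl).hom.app X)
  | Int.ofNat n, _, X => by
    have e : (extend b b' φ (Int.ofNat n + 1) X).hom =
        L.map ((suspIso S n (n + 1 : ℕ) rfl).inv.app X) ≫ (extendNat φ n (S.obj X)).hom ≫
          L'.map ((suspIso S n (n + 1 : ℕ) rfl).hom.app X) := rfl
    rw [e]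
    refine (Category.assoc _ _ _).symm.trans ?_
    refine (congrArg (· ≫ _) (L.map_comp _ _).symm).trans ?_
    refine (congrArg (· ≫ _) (congrArg L.map ((suspIso S n (n + 1 : ℕ) rfl).hom_inv_id_app X))).trans ?_
    refine (congrArg (· ≫ _) (L.map_id _)).trans ?_
    exact Category.id_comp _

lemma extend_bott_neg : ∀ (m : ℤ) (_ : m < 0) (X : H),
    b.hom.app ((incl S m).obj X) ≫ (extend b b' φ (m + 1 + 1) X).hom =
      (extend b b' φ m X).hom ≫ b'.hom.app ((incl S m).obj X)
  | Int.negSucc 0, _, X => by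
    refine Eq.symm ((Category.assoc _ _ _).trans (congrArg _ ((Category.assoc _ _ _).trans ?_)))
    exact (congrArg _ (b'.inv_hom_id_app _)).trans (Category.comp_id _)
  | Int.negSucc 1, _, X => by
    refine Eq.symm ((Category.assoc _ _ _).trans (congrArg _ ((Category.assoc _ _ _).trans ?_)))
    exact (congrArg _ (b'.inv_hom_id_app _)).trans (Category.comp_id _)
  | Int.negSucc (n + 2), _, X => by
    refine Eq.symm ((Category.assoc _ _ _).trans (congrArg _ ((Category.assoc _ _ _).trans ?_)))
    exact (congrArg _ (b'.inv_hom_id_app _)).trans (Category.comp_id _)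

/-- Five commuting faces of a cube force the sixth, given one cancellable edge. The two variants
carry squares up from degree `m` to `m + 1`, and down from `m + 2` to `m`. -/
lemma cube_right {A₀ A₁ A₂ A₃ B₀ B₁ B₂ B₃ : 𝒜} {l : A₀ ⟶ A₁} {r : A₂ ⟶ A₃} {t : A₀ ⟶ A₂}
    {u : A₁ ⟶ A₃} {l' : B₀ ⟶ B₁} {r' : B₂ ⟶ B₃} {t' : B₀ ⟶ B₂} {u' : B₁ ⟶ B₃}
    {ψ₀ : A₀ ⟶ B₀} {ψ₁ : A₁ ⟶ B₁} {ψ₂ : A₂ ⟶ B₂} {ψ₃ : A₃ ⟶ B₃} (h : t ≫ r = l ≫ u)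
    (h' : t' ≫ r' = l' ≫ u') (hl : l ≫ ψ₁ = ψ₀ ≫ l') (hr : r ≫ ψ₃ = ψ₂ ≫ r')
    (ht : t ≫ ψ₂ = ψ₀ ≫ t') [Epi l] : u ≫ ψ₃ = ψ₁ ≫ u' := by
  rw [← cancel_epi l, ← Category.assoc, ← h, Category.assoc, hr, reassoc_of% ht, h',
    reassoc_of% hl]

lemma cube_left {A₀ A₁ A₂ A₃ B₀ B₁ B₂ B₃ : 𝒜} {l : A₀ ⟶ A₁} {r : A₂ ⟶ A₃} {t : A₀ ⟶ A₂}
    {u : A₁ ⟶ A₃} {l' : B₀ ⟶ B₁} {r' : B₂ ⟶ B₃} {t' : B₀ ⟶ B₂} {u' : B₁ ⟶ B₃}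
    {ψ₀ : A₀ ⟶ B₀} {ψ₁ : A₁ ⟶ B₁} {ψ₂ : A₂ ⟶ B₂} {ψ₃ : A₃ ⟶ B₃} (h : t ≫ r = l ≫ u)
    (h' : t' ≫ r' = l' ≫ u') (hr : r ≫ ψ₃ = ψ₂ ≫ r') (ht : t ≫ ψ₂ = ψ₀ ≫ t')
    (hu : u ≫ ψ₃ = ψ₁ ≫ u') [Mono u'] : l ≫ ψ₁ = ψ₀ ≫ l' := by
  rw [← cancel_mono u', Category.assoc, Category.assoc, ← hu, ← reassoc_of% h, hr,
    reassoc_of% ht, h']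

/-- Nonnegative degrees are reached by suspension, negative ones by periodicity, following how
`extend` was built. -/
lemma extend_natural (hφ : ∀ ⦃X Y : H⦄ (f : X ⟶ Y), L.map ((incl S 0).map f) ≫ (φ Y).hom =
    (φ X).hom ≫ L'.map ((incl S 0).map f)) (m : ℤ) : ∀ ⦃X Y : H⦄ (f : X ⟶ Y),
    L.map ((incl S m).map f) ≫ (extend b b' φ m Y).hom =
      (extend b b' φ m X).hom ≫ L'.map ((incl S m).map f) := by
  induction m using int_two_step with
  | h0 m hm =>
    induction m, hm using int_nonneg_induction with
    | h0 => exact hφ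
    | h m hm ih =>
      intro X Y f
      have hn := (suspIso S m (m + 1) rfl).hom.naturality f
      have h1 := ((L.map_comp _ _).symm.trans (congrArg L.map hn)).trans (L.map_comp _ _)
      have h2 := ((L'.map_comp _ _).symm.trans (congrArg L'.map hn)).trans (L'.map_comp _ _)
      exact cube_right h1 h2 (extend_succ b b' φ m hm X) (extend_succ b b' φ m hm Y)
        (ih (S.map f))
  | h m hm ih =>
    intro X Y f
    exact cube_left (b.hom.naturality ((incl S m).map f)).symm
      (b'.hom.naturality ((incl S m).map f)).symm (ih f) (extend_bott_neg b b' φ m hm X)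
      (extend_bott_neg b b' φ m hm Y)

/-- For negative degrees this is the construction. In degree `0` it is the hypothesis, rewritten by
splitting the double shift into two single steps; naturality of `b` and `b'` then carries it
upwards. -/
lemma extend_bott (hφ : ∀ X : H,
    b.hom.app ((incl S 0).obj X) ≫ L.map (doubleShiftIso S X).hom ≫ (φ (S.obj (S.obj X))).hom =
      (φ X).hom ≫ b'.hom.app ((incl S 0).obj X) ≫ L'.map (doubleShiftIso S X).hom)
    (m : ℤ) : ∀ X : H,
    b.hom.app ((incl S m).obj X) ≫ (extend b b' φ (m + 1 + 1) X).hom =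
      (extend b b' φ m X).hom ≫ b'.hom.app ((incl S m).obj X) := by
  rcases lt_or_ge m 0 with hm | hm
  · exact extend_bott_neg b b' φ m hm
  · induction m, hm using int_nonneg_induction with
    | h0 =>
      intro X
      have h1 := extend_succ b b' φ 0 le_rfl (S.obj X)
      have h2 := extend_succ b b' φ 1 zero_le_one X
      have key : L.map (doubleShiftIso S X).inv ≫ (extend b b' φ 2 X).hom =
          (φ (S.obj (S.obj X))).hom ≫ L'.map (doubleShiftIso S X).inv := by
        have e := (congrArg L.map (doubleShiftIso_inv (S := S) X)).trans (L.map_comp _ _)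
        have e' := (congrArg L'.map (doubleShiftIso_inv (S := S) X)).trans (L'.map_comp _ _)
        rw [e, e']
        refine (Category.assoc _ _ _).trans ((congrArg _ h2).trans ?_)
        exact (Category.assoc _ _ _).symm.trans ((congrArg (· ≫ _) h1).trans (Category.assoc _ _ _))
      have h3 : (extend b b' φ 2 X).hom = L.map (doubleShiftIso S X).hom ≫
          (φ (S.obj (S.obj X))).hom ≫ L'.map (doubleShiftIso S X).inv := by
        exact ((Iso.inv_comp_eq (L.mapIso (doubleShiftIso S X))).1 key)
      refine (congrArg (b.hom.app _ ≫ ·) h3).trans ?_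
      have h4 := congrArg (· ≫ L'.map (doubleShiftIso S X).inv) (hφ X)
      simp only [Category.assoc, ← L'.map_comp, Iso.hom_inv_id, L'.map_id] at h4
      exact h4.trans (congrArg _ (Category.comp_id _))
    | h m hm ih =>
      intro X
      exact cube_right (b.hom.naturality ((suspIso S m (m + 1) rfl).hom.app X)).symm
        (b'.hom.naturality ((suspIso S m (m + 1) rfl).hom.app X)).symm
        (extend_succ b b' φ m hm X) (extend_succ b b' φ (m + 1 + 1) (by omega) X) (ih (S.obj X))

/-- An isomorphism in degree `0` that is compatible with the periodicity isomorphisms extends to the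
stabilisation. -/
theorem exists_bott_iso
    (hφn : ∀ ⦃X Y : H⦄ (f : X ⟶ Y), L.map ((incl S 0).map f) ≫ (φ Y).hom =
      (φ X).hom ≫ L'.map ((incl S 0).map f))
    (hφ : ∀ X : H,
      b.hom.app ((incl S 0).obj X) ≫ L.map (doubleShiftIso S X).hom ≫ (φ (S.obj (S.obj X))).hom =
        (φ X).hom ≫ b'.hom.app ((incl S 0).obj X) ≫ L'.map (doubleShiftIso S X).hom) :
    ∃ θ : L ≅ L', (∀ X, θ.hom.app ((incl S 0).obj X) = (φ X).hom) ∧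
      ∀ Z, b.hom.app Z ≫ θ.hom.app ((shift S).obj ((shift S).obj Z)) =
        θ.hom.app Z ≫ b'.hom.app Z := by
  refine ⟨natIsoMk (fun X => extend b b' φ X.deg X.obj) (extend_natural b b' φ hφn) ?_,
    fun X => rfl, fun Z => extend_bott b b' φ hφ Z.deg Z.obj⟩
  intro m
  change ∀ X : H, L.map ((suspIso S m (m + 1) rfl).hom.app X) ≫ (extend b b' φ (m + 1) X).hom =
    (extend b b' φ m (S.obj X)).hom ≫ L'.map ((suspIso S m (m + 1) rfl).hom.app X)
  induction m using int_two_step with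
  | h0 m hm => exact extend_succ b b' φ m hm
  -- In negative degrees compatibility with suspension was not built in; it descends two degrees at
  -- a time along periodicity.
  | h m hm ih =>
    intro X
    exact cube_left (b.hom.naturality ((suspIso S m (m + 1) rfl).hom.app X)).symm
      (b'.hom.naturality ((suspIso S m (m + 1) rfl).hom.app X)).symm (ih X)
      (extend_bott b b' φ hφ m (S.obj X)) (extend_bott b b' φ hφ (m + 1) X)

/-- A transformation that is compatible with periodicity isomorphisms is determined in degree `0`. -/
theorem bott_hom_ext (θ θ' : L ⟶ L')
    (h0 : ∀ X, θ.app ((incl S 0).obj X) = θ'.app ((incl S 0).obj X))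
    (hb : ∀ Z, b.hom.app Z ≫ θ.app ((shift S).obj ((shift S).obj Z)) = θ.app Z ≫ b'.hom.app Z)
    (hb' : ∀ Z, b.hom.app Z ≫ θ'.app ((shift S).obj ((shift S).obj Z)) =
      θ'.app Z ≫ b'.hom.app Z) : θ = θ' := by
  have key : ∀ (m : ℤ) (X : H), θ.app ((incl S m).obj X) = θ'.app ((incl S m).obj X) := by
    intro m
    induction m using int_two_step with
    | h0 m hm =>
      induction m, hm using int_nonneg_induction with
      | h0 => exact h0
      | h m hm ih =>
        intro X
        rw [← cancel_epi (L.map ((suspIso S m (m + 1) rfl).hom.app X)), θ.naturality,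
          θ'.naturality]
        exact congrArg (· ≫ _) (ih (S.obj X))
    | h m hm ih =>
      intro X
      rw [← cancel_mono (b'.hom.app ((incl S m).obj X)), ← hb, ← hb']
      exact congrArg (_ ≫ ·) (ih X)
  ext Z
  exact key Z.deg Z.obj

end unique

end Stab

namespace CStarAlgCat

variable {A B I : CStarAlgCat.{u}} {𝒜 : Type v} [Category.{w} 𝒜]

/-! ### Homotopy invariant split exact functors invert the kernel class -/

/-- The zero C⋆-algebra. -/
def zeroAlg : CStarAlgCat.{u} where
  carrier := PEmpty.{u + 1} → ℂ

lemma isSplitExtension_zeroAlg : IsSplitExtension (𝟙 zeroAlg.{u}) (𝟙 zeroAlg.{u}) where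
  injective := Function.injective_id
  exact a := ⟨fun _ => ⟨a, rfl⟩, fun _ => funext fun x => x.elim⟩
  split := ⟨𝟙 _, Category.comp_id _⟩

/-- Split exactness for the extension `0 → 0 → 0` gives `F 0 = 0`; homotopy invariance then kills
contractible algebras, so the splitting degenerates to an isomorphism. -/
lemma IsSplitExact.isIso_map_of_kernelClass [Preadditive 𝒜] {F : CStarAlgCat.{u} ⥤ 𝒜}
    (hF : IsSplitExact F) (hi : IsHomotopyInvariant F) {ι : I ⟶ A} (h : kernelClass ι) :
    IsIso (F.map ι) := by
  obtain ⟨B, π, h, hB⟩ := h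
  obtain ⟨w₀, -⟩ := hF _ _ isSplitExtension_zeroAlg.{u}
  have h0 : 𝟙 (F.obj zeroAlg) = 0 := by simpa using w₀
  have h1 : zeroHom B B = zeroHom B zeroAlg ≫ zeroHom zeroAlg B := by rw [zeroHom_comp]
  have hB' : 𝟙 (F.obj B) = 0 := by
    rw [← F.map_id, hi _ _ hB, h1, F.map_comp, ← Category.id_comp (F.map (zeroHom zeroAlg B)), h0,
      Limits.zero_comp, Limits.comp_zero]
  obtain ⟨w, ⟨σ⟩⟩ := hF ι π h
  refine ⟨σ.r, σ.f_r, ?_⟩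
  have hid := σ.id
  have hs : σ.s = 0 := (Category.id_comp _).symm.trans
    ((congrArg (· ≫ σ.s) hB').trans Limits.zero_comp)
  rw [hs, Limits.comp_zero, add_zero] at hid
  exact hid

/-! ### The functor induced on the localisation -/

section existence

variable (F : CStarAlgCat.{u} ⥤ 𝒜) (β : BottIso F) (hi : IsHomotopyInvariant F)

/-- The functor on the homotopy category induced by a homotopy invariant functor. -/
def hoLift : HoCStar.{u} ⥤ 𝒜 :=
  CategoryTheory.Quotient.lift _ F fun _ _ f g h => hi f g h

/-- The induced periodicity isomorphism on the homotopy category. -/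
def hoBott : hoLift F hi ≅ hoSusp ⋙ hoSusp ⋙ hoLift F hi :=
  NatIso.ofComponents (fun X => β.app X.as) (by
    rintro X Y ⟨f⟩
    exact β.hom.naturality f)

lemma isIso_iterComp_map (hk : ∀ ⦃I A : CStarAlgCat.{u}⦄ (ι : I ⟶ A), kernelClass ι →
    IsIso (F.map ι)) (n : ℕ) {I A : CStarAlgCat.{u}} (ι : I ⟶ A) (h : kernelClass ι) :
    IsIso ((Stab.iterComp hoSusp (hoLift F hi) n).map ((Quotient.functor Homotopic).map ι)) := by
  induction n generalizing I A with
  | zero => exact hk ι h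
  | succ n ih => exact ih (suspMap ι) h.susp

/-- The functor on the stable homotopy category induced by a homotopy invariant Bott periodic
functor. -/
abbrev stableLift : SH.{u} ⥤ 𝒜 := Stab.bottDescend (hoLift F hi) (hoBott F β hi)

lemma stableLift_inverts (hk : ∀ ⦃I A : CStarAlgCat.{u}⦄ (ι : I ⟶ A), kernelClass ι →
    IsIso (F.map ι)) : stableKernelClass.IsInvertedBy (stableLift F β hi) := by
  intro X Y f hf
  induction hf with
  | @kernel m I A ι hι =>
    have e : (stableLift F β hi).map ((toSH m).map ι) = _ :=
      Stab.descend_map_incl _ (Stab.degIso _ (hoBott F β hi)) m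
        ((Quotient.functor Homotopic).map ι)
    rw [e]
    cases m with
    | ofNat n => exact isIso_iterComp_map F hi hk n ι hι
    | negSucc n => exact isIso_iterComp_map F hi hk (n + 1) ι hι
  | iso f hf => infer_instance
  | comp f g _ _ hf hg => rw [Functor.map_comp]; infer_instance

end existence

/-! ### Transfer of natural isomorphisms along the localisation functor -/

/-- An isomorphism of functors on the localisation from one on the original category. -/
def locNatIso {G G' : SHLoc.{u} ⥤ 𝒜} (τ : locFunctor ⋙ G ≅ locFunctor ⋙ G') : G ≅ G' where
  hom := Localization.Construction.natTransExtension τ.hom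
  inv := Localization.Construction.natTransExtension τ.inv
  hom_inv_id := Localization.Construction.natTrans_hcomp_injective (by ext; simp)
  inv_hom_id := Localization.Construction.natTrans_hcomp_injective (by ext; simp)

lemma locNatIso_hom_app {G G' : SHLoc.{u} ⥤ 𝒜} (τ : locFunctor ⋙ G ≅ locFunctor ⋙ G')
    (X : SH.{u}) : (locNatIso τ).hom.app (locFunctor.obj X) = τ.hom.app X :=
  Localization.Construction.NatTransExtension.app_eq τ.hom X

lemma locLift_map {ℬ : Type*} [Category* ℬ] {L : SH.{u} ⥤ ℬ}
    (hL : stableKernelClass.IsInvertedBy L) {X Y : SH.{u}} (f : X ⟶ Y) :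
    (Localization.Construction.lift L hL).map (locFunctor.map f) = L.map f :=
  (Functor.congr_hom (Localization.Construction.fac L hL) f).trans
    ((Category.id_comp _).trans (Category.comp_id _))

lemma locSusp_map {X Y : SH.{u}} (f : X ⟶ Y) :
    locSusp.map (locFunctor.map f) = locFunctor.map ((Stab.shift hoSusp).map f) :=
  locLift_map _ f

/-- The periodicity isomorphism on the stable homotopy category induced by one on the
localisation. -/
def stableBott {G : SHLoc.{u} ⥤ 𝒜} (b : G ≅ locSusp ⋙ locSusp ⋙ G) : locFunctor ⋙ G ≅
    Stab.shift hoSusp ⋙ Stab.shift hoSusp ⋙ locFunctor ⋙ G :=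
  NatIso.ofComponents (fun X => b.app (locFunctor.obj X)) (fun {X Y} f => by
    have h := b.hom.naturality (locFunctor.map f)
    have e : (locSusp ⋙ locSusp ⋙ G).map (locFunctor.map f) =
        (Stab.shift hoSusp ⋙ Stab.shift hoSusp ⋙ locFunctor ⋙ G).map f :=
      (congrArg G.map ((congrArg locSusp.map (locSusp_map f)).trans (locSusp_map _)) :)
    rw [e] at h
    exact h)

/-- The periodicity isomorphism on the localisation induced by one on the stable homotopy
category. -/
def locBott {L : SH.{u} ⥤ 𝒜} (hL : stableKernelClass.IsInvertedBy L)
    (b : L ≅ Stab.shift hoSusp ⋙ Stab.shift hoSusp ⋙ L) :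
    Localization.Construction.lift L hL ≅
      locSusp ⋙ locSusp ⋙ Localization.Construction.lift L hL :=
  locNatIso (NatIso.ofComponents (fun X => b.app X) (fun {X Y} f => by
    have e : (locFunctor ⋙ locSusp ⋙ locSusp ⋙ Localization.Construction.lift L hL).map f =
        (Stab.shift hoSusp ⋙ Stab.shift hoSusp ⋙ L).map f :=
      (congrArg (Localization.Construction.lift L hL).map
        ((congrArg locSusp.map (locSusp_map f)).trans (locSusp_map _))).trans (locLift_map hL _)
    have e' : (locFunctor ⋙ Localization.Construction.lift L hL).map f = L.map f :=
      locLift_map hL f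
    rw [e, e']
    exact b.hom.naturality f))

theorem exists_bottFactorization [Preadditive 𝒜] (F : CStarAlgCat.{u} ⥤ 𝒜) (β : BottIso F)
    (hF : IsSplitExact F) (hi : IsHomotopyInvariant F) : Nonempty (BottFactorization F β) := by
  have hL := stableLift_inverts F β hi fun _ _ _ h => hF.isIso_map_of_kernelClass hi h
  refine ⟨{
    functor := Localization.Construction.lift (stableLift F β hi) hL
    bott := locBott hL (Stab.bottDescendIso (hoLift F hi) (hoBott F β hi))
    iso := NatIso.ofComponents (fun A => Iso.refl (F.obj A)) (fun {A B} f => ?_)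
    compat := fun A => ?_ }⟩
  · have e : (toSHLoc ⋙ Localization.Construction.lift (stableLift F β hi) hL).map f = F.map f :=
      (locLift_map hL ((toSH 0).map f)).trans
        (Stab.descend_map_incl _ (Stab.degIso _ (hoBott F β hi)) 0
          ((Quotient.functor Homotopic).map f))
    rw [e]
    exact (Category.comp_id _).trans (Category.id_comp _).symm
  · refine (Category.comp_id _).trans (Eq.symm ((Category.id_comp _).trans ?_))
    refine Eq.trans (congrArg₂ (· ≫ ·) (locNatIso_hom_app _ ((toSH 0).obj A))
      (locLift_map hL (Stab.doubleShiftIso hoSusp ((Quotient.functor _).obj A)).hom)) ?_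
    exact Stab.bottDescendIso_doubleShiftIso (hoLift F hi) (hoBott F β hi)
      ((Quotient.functor _).obj A)

/-! ### Uniqueness -/

/-- The identifications with `F` prescribe the comparison on `A_0`, and the two `compat` squares are
exactly what extending it to all degrees requires. Passing to the localisation adds no freedom. -/
theorem existsUnique_isCompatible {F : CStarAlgCat.{u} ⥤ 𝒜} {β : BottIso F}
    (G G' : BottFactorization F β) : ∃! θ : G.functor ≅ G'.functor, G.IsCompatible G' θ := by
  let φ : ∀ X : HoCStar.{u}, (locFunctor ⋙ G.functor).obj ((Stab.incl hoSusp 0).obj X) ≅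
      (locFunctor ⋙ G'.functor).obj ((Stab.incl hoSusp 0).obj X) :=
    fun X => (G.iso.app X.as).symm ≪≫ G'.iso.app X.as
  obtain ⟨τ, hτ, hτb⟩ := Stab.exists_bott_iso (stableBott G.bott) (stableBott G'.bott) φ
    (by
      rintro X Y ⟨f⟩
      have h1 := G.iso.hom.naturality f
      have h2 := G'.iso.hom.naturality f
      change (toSHLoc ⋙ G.functor).map f ≫ G.iso.inv.app Y.as ≫ G'.iso.hom.app Y.as =
        (G.iso.inv.app X.as ≫ G'.iso.hom.app X.as) ≫ (toSHLoc ⋙ G'.functor).map f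
      rw [Category.assoc, ← h2, G.iso.inv.naturality_assoc])
    (fun X => by
      have h1 := G.compat X.as
      have h2 := G'.compat X.as
      change G.bott.hom.app (toSHLoc.obj X.as) ≫ G.functor.map (locDoubleSuspIso X.as).hom ≫
          G.iso.inv.app (susp (susp X.as)) ≫ G'.iso.hom.app (susp (susp X.as)) =
        (G.iso.inv.app X.as ≫ G'.iso.hom.app X.as) ≫ G'.bott.hom.app (toSHLoc.obj X.as) ≫
          G'.functor.map (locDoubleSuspIso X.as).hom
      rw [Category.assoc, ← h2, ← cancel_epi (G.iso.hom.app X.as)]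
      simp only [Iso.hom_inv_id_app_assoc]
      rw [← reassoc_of% h1]
      exact (Category.assoc _ _ _).trans
        (congrArg _ (G.iso.hom_inv_id_app_assoc (susp (susp X.as)) _)))
  refine ⟨locNatIso τ, ⟨fun A => ?_, fun Z => ?_⟩, fun θ hθ => ?_⟩
  · refine (congrArg _ ((locNatIso_hom_app τ ((toSH 0).obj A)).trans
      (hτ ((Quotient.functor _).obj A)))).trans ?_
    exact G.iso.hom_inv_id_app_assoc A _
  · have h := hτb (Z.as : _).obj
    rw [← locNatIso_hom_app, ← locNatIso_hom_app] at h
    exact h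
  · apply Iso.ext
    apply Localization.Construction.natTrans_hcomp_injective
    have key : (CategoryTheory.Functor.whiskerLeft locFunctor θ.hom : locFunctor ⋙ G.functor ⟶
        locFunctor ⋙ G'.functor) = τ.hom := by
      refine Stab.bott_hom_ext (stableBott G.bott) (stableBott G'.bott) _ _ (fun X => ?_)
        (fun Z => hθ.bott (locFunctor.obj Z)) hτb
      refine Eq.trans ?_ (hτ X).symm
      exact (Iso.eq_inv_comp (G.iso.app X.as)).2 (hθ.iso X.as)
    ext X
    simp only [NatTrans.id_hcomp_app]
    exact (congrArg (fun t => t.app X) key).trans (locNatIso_hom_app τ X).symm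

end CStarAlgCat

end

theorem mainTheorem1 :
    (∃ (P : Preadditive CStarAlgCat.SH.{u}) (P' : Preadditive CStarAlgCat.SHLoc.{u}),
      CStarAlgCat.IsConcatAddition P ∧
      CStarAlgCat.locFunctor.{u}.Additive ∧
      ∀ D : CStarAlgCat.{u},
        CStarAlgCat.IsSplitExact
          (CStarAlgCat.toSHLoc ⋙ preadditiveCoyoneda.obj (Opposite.op (CStarAlgCat.toSHLoc.obj D))) ∧
        CStarAlgCat.IsSplitExactOp
          (CStarAlgCat.toSHLoc.op ⋙ preadditiveYoneda.obj (CStarAlgCat.toSHLoc.obj D))) ∧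
    (∀ (𝒜 : Type v) [Category.{w} 𝒜] [Preadditive 𝒜] (F : CStarAlgCat.{u} ⥤ 𝒜)
      (β : CStarAlgCat.BottIso F),
      CStarAlgCat.IsSplitExact F → CStarAlgCat.IsHomotopyInvariant F →
      Nonempty (CStarAlgCat.BottFactorization F β) ∧
      ∀ G G' : CStarAlgCat.BottFactorization F β,
        ∃! θ : G.functor ≅ G'.functor, G.IsCompatible G' θ) :=
  ⟨⟨inferInstance, inferInstance, CStarAlgCat.isConcatAddition, inferInstance, fun D =>
    ⟨CStarAlgCat.isSplitExact_coyoneda D, CStarAlgCat.isSplitExactOp_yoneda D⟩⟩,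
    fun _ _ _ F β hF hi => ⟨CStarAlgCat.exists_bottFactorization F β hF hi,
      CStarAlgCat.existsUnique_isCompatible⟩⟩
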